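/- **Setting.** Let $s,q,K,H,p\ge 0$ be integers and let $A_{kh}$ ($0\le k\le K$, $0\le h\le H$) be $s\times s$ matrices whose entries are rational functions of $\theta=(\theta_1,\dots,\theta_p)\in\mathbb R^p$, given as quotients of real polynomials with non-zero denominators. Put $A^*_i=\sum_{h-k=i}A_{kh}$, let $J_0$ and $J_1$ be the smallest and the largest $i$ with $A_i^*\ne0$, and put $\pi(z)=\sum_{i=J_0}^{J_1}A_i^*z^{J_1-i}$. A Smith form of $\pi$ is a factorisation $\pi=P\,\alpha\,\Phi\,Q$ with $P,Q$ unimodular polynomial matrices, $\alpha=\mathrm{diag}(z^{g_1},\dots,z^{g_s})$, $0\le g_1\le\dots\le g_s$, and $\Phi$ a diagonal polynomial matrix, each diagonal entry dividing the next, with $\det\Phi(0)\neq0$. Let $m_{n}$ ($n\ge0$) be the $s\times sH$ matrix whose $j$-th $s\times s$ block ($0\le j\le H-1$) is $-\sum A_{kh}$, the sum being over $0\le k\le K$, $0\le h\le j$ with $k+j-h=n$. Let $N=H-J_1+g_s$, let $D$ be the $sH\times sN$ matrix whose row $(i,k)$ ($0\le i\le H-1$, $1\le k\le s$) has in block column $n$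 ($0\le n\le N-1$) the coefficient of $z^{\,i+g_k-J_1-n}$ in the $k$-th row of $P(z)^{-1}$ (zero if the exponent is negative), and let $C=D\,(m_0^T,\dots,m_{N-1}^T)^T\in\mathbb R^{sH\times sH}$. Random variables are in $L^2(\Omega)$, with $\mathbb E(xy)$ as inner product. Let $u_t$ ($t\in\mathbb Z$) be an $s$-dimensional process with Wold representation $u_t=\sum_{j\ge0}w_j\varepsilon_{t-j}$, $w_j\in\mathbb R^{s\times q}$, $\sum_j w_jw_j^T<\infty$: $\varepsilon$ is $q$-dimensional white noise, $\mathbb E(\varepsilon_t\varepsilon_{t'}^T)=0$ for $t\ne t'$ and $\mathbb E(\varepsilon_t\varepsilon_t^T)$ is constant in $t$ of rank $q$, and the components of $\varepsilon_t$ lie in $H_u(t)$, the closed linear span of the components of $u_t,u_{t-1},\dots$ (so that automatically $q\le\mathrm{rank}\,\mathbb E(u_tu_t^T)\le s$). $\mathbb E_t$ is the orthogonal projection onto $H_u(t)$. A process $y$ is *causal stationary* if $y_t=\sum_{j\ge0}k_j\varepsilon_{t-j}$ with constant $k_j\in\mathbb R^{s\times q}$ and mean-square convergence. It solves the *RE model*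 if the components of $y_t$ lie in $H_u(t)$ and $\sum_{k,h}A_{kh}\mathbb E_{t-k}(y_{t+h-k})=-u_t$ for all $t$. For $s$-dimensional martingale difference sequences $\varepsilon^0,\dots,\varepsilon^{H-1}$ ($\mathbb E_t\varepsilon^j_t=\varepsilon^j_t$, $\mathbb E_{t-1}\varepsilon^j_t=0$) let $\zeta_t=-\sum_{k=0}^K\sum_{j=0}^{H-1}\sum_{h=0}^{j}A_{kh}\varepsilon^j_{t-(k+j-h)}$. With $z$ also denoting the backward shift, the *structural difference equation* (SDE) is $$\pi(z)y_t=\pi(z)\bigl(\varepsilon^0_t+\varepsilon^1_{t-1}+\dots+\varepsilon^{H-1}_{t-H+1}\bigr)+\zeta_{t-J_1}-u_{t-J_1}\quad\text{for all }t,$$ with the *constraints* $$C\begin{pmatrix}\varepsilon^0_t\\ \vdots\\ \varepsilon^{H-1}_t\end{pmatrix}=D\,(\mathbb E_t-\mathbb E_{t-1})\begin{pmatrix}u_t\\ \vdots\\ u_{t+H-J_1+g_s-1}\end{pmatrix}\quad\text{for all }t .$$ The *free parameters* of the SDE are the $(h_0,\dots,h_{H-1})$, $h_j\in\mathbb R^{s\times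 q}$, for which $\varepsilon^j_t=h_j\varepsilon_t$ satisfies the constraints. **Theorem.** Assume that, as rational functions of $\theta$, some $A_{Kh}$ and some $A_{kH}$ are non-zero and $\det\pi(z)\not\equiv0$, and that for a Smith form of $\pi$ over $\mathbb R(\theta)[z]$ the matrix $C$ has rank $w\le (H-J_1)s+\sum_{i=1}^s\min(g_i,J_1)$. Then there is a non-zero polynomial $F$ such that the following holds for every $\theta$ with $F(\theta)\ne0$. At $\theta$ no denominator vanishes, the same assumptions hold with the same $J_1$, and the given Smith form evaluated at $\theta$ is a Smith form of $\pi_\theta$, with the same $g_i$ and with $\mathrm{rank}\,C=w$. Moreover, for every Smith form of $\pi_\theta$, with $w$ now denoting the rank of the corresponding $C$, and for every exogenous process $u$ as above: 1. For a causal stationary process $y$ the following are equivalent: $y$ solves the RE model; $y$ solves the SDE for some martingale difference sequences satisfying the constraints; $y$ solves the SDE with $\varepsilon^j_t=h_j\varepsilon_t$ for some free parameters $(h_0,\dots,h_{H-1})$. 2. The SDE has $(Hs-w)q$ free parameters: unless the constraints are inconsistent, the set of free parameters is an affine space of dimension $(Hs-w)q$. 3. Assume in addition that all non-zero zeros of $\det\pi_\theta$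 lie outside the closed unit disc. Then causal stationary solutions of the SDE generated by two distinct free parameters are distinct. A free parameter generates exactly one causal stationary solution of the SDE if and only if all components of $\alpha(z)^{-1}P(z)^{-1}(\zeta_{t-J_1}-u_{t-J_1})$ lie in $H_u(t)$ for all $t$; this is always the case if $g_i\le J_1$ for all $i$. -/

import Mathlib

open MeasureTheory Polynomial

noncomputable section

namespace RE

/-! ### The coefficients of the model and the matrix polynomial `π` -/

section Algebra

variable {F : Type*} [Field F] {s K H : ℕ}

/-- The coefficient matrices `A_{kh}`, `0 ≤ k ≤ K`, `0 ≤ h ≤ H`. -/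
abbrev Coeffs (F : Type*) (s K H : ℕ) : Type _ :=
  Fin (K + 1) → Fin (H + 1) → Matrix (Fin s) (Fin s) F

/-- `A*_i`, the sum of the `A_{kh}` with `h - k = i`. -/
def Astar (A : Coeffs F s K H) (i : ℤ) : Matrix (Fin s) (Fin s) F :=
  ∑ k : Fin (K + 1), ∑ h : Fin (H + 1),
    if ((h : ℕ) : ℤ) - ((k : ℕ) : ℤ) = i then A k h else 0

/-- The smallest `i` with `A*_i ≠ 0`. -/
def J0 (A : Coeffs F s K H) : ℤ := sInf {i : ℤ | Astar A i ≠ 0}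

/-- The largest `i` with `A*_i ≠ 0`. -/
def J1 (A : Coeffs F s K H) : ℤ := sSup {i : ℤ | Astar A i ≠ 0}

/-- `π(z) = ∑_{i=J₀}^{J₁} A*_i z^{J₁-i}`. -/
def piPoly (A : Coeffs F s K H) : Matrix (Fin s) (Fin s) F[X] :=
  ∑ i ∈ Finset.Icc (J0 A) (J1 A), (Astar A i).map (fun a => monomial (J1 A - i).toNat a)

/-- `K` and `H` are the true orders, and `det π` is not identically zero. -/
structure Regular (A : Coeffs F s K H) : Prop where
  last_row : ∃ h, A (Fin.last K) h ≠ 0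
  last_col : ∃ k, A k (Fin.last H) ≠ 0
  det_ne_zero : (piPoly A).det ≠ 0

/-- A Smith factorisation `M(z) = P(z) α(z) Φ(z) Q(z)` in which `P`, `Q` are unimodular,
`α = diag(z^{g_1}, …, z^{g_s})` collects the zeros at zero, and `Φ = diag(φ_1, …, φ_s)` has no
zero at zero; the diagonal entries of `α` and of `Φ` form divisibility chains. -/
structure SmithForm (M : Matrix (Fin s) (Fin s) F[X]) where
  P : Matrix (Fin s) (Fin s) F[X]
  Q : Matrix (Fin s) (Fin s) F[X]
  g : Fin s → ℕ
  φ : Fin s → F[X]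
  isUnit_det_P : IsUnit P.det
  isUnit_det_Q : IsUnit Q.det
  g_mono : Monotone g
  φ_dvd : ∀ i j : Fin s, i ≤ j → φ i ∣ φ j
  φ_zero : ∀ i, (φ i).coeff 0 ≠ 0
  eq : M = P * Matrix.diagonal (fun i => (X : F[X]) ^ g i) * Matrix.diagonal φ * Q

/-- The coefficient `m_n` of lag `n` in `ζ_t = ∑_n m_n ε^•_{t-n}`, where
`ζ_t = -∑_k ∑_{j<H} ∑_{h≤j} A_{kh} z^{k+j-h} ε^j_t` and `ε^•` stacks `ε^0, …, ε^{H-1}`. -/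
def zetaCoeff (A : Coeffs F s K H) (n : ℕ) : Matrix (Fin s) (Fin H × Fin s) F :=
  Matrix.of fun a jb =>
    -∑ k : Fin (K + 1), ∑ h : Fin (H + 1),
      if (h : ℕ) ≤ (jb.1 : ℕ) ∧ (k : ℕ) + (jb.1 : ℕ) = n + (h : ℕ) then A k h a jb.2 else 0

/-- The number `H - J₁ + g_s` of leads of `u` that enter the constraints. -/
def numLeads {A : Coeffs F s K H} (S : SmithForm (piPoly A)) : ℕ :=
  ((H : ℤ) - J1 A + ((Finset.univ.sup S.g : ℕ) : ℤ)).toNat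

/-- The matrix `D`. Its row `(i, k)` lists the coefficients with which `x_t, x_{t+1}, …` enter the
`k`-th entry of `z^{-i} α(z)⁻¹ P(z)⁻¹ x_{t-J₁}`; the coefficient of `x_{t+n}` is that of
`z^{i+g_k-J₁-n}` in the `k`-th row of `P(z)⁻¹`. -/
def Dmat {A : Coeffs F s K H} (S : SmithForm (piPoly A)) :
    Matrix (Fin H × Fin s) (Fin (numLeads S) × Fin s) F :=
  Matrix.of fun ik nb =>
    let l : ℤ := ((ik.1 : ℕ) : ℤ) + ((S.g ik.2 : ℕ) : ℤ) - J1 A - ((nb.1 : ℕ) : ℤ)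
    if 0 ≤ l then (S.P⁻¹ ik.2 nb.2).coeff l.toNat else 0

/-- The matrix `C = D (m_0; m_1; …)` of size `sH × sH`. -/
def Cmat {A : Coeffs F s K H} (S : SmithForm (piPoly A)) :
    Matrix (Fin H × Fin s) (Fin H × Fin s) F :=
  Dmat S * Matrix.of fun nb jc => zetaCoeff A (nb.1 : ℕ) nb.2 jc

end Algebra

/-! ### Rationally parametrised coefficients -/

section Parameters

variable {p s K H : ℕ}

/-- The field of rational functions in `θ_1, …, θ_p`. -/
abbrev RatField (p : ℕ) : Type := FractionRing (MvPolynomial (Fin p) ℝ)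

/-- The coefficients `A_{kh} = num / den` as rational functions of the parameters. -/
def genericCoeffs (num den : Coeffs (MvPolynomial (Fin p) ℝ) s K H) :
    Coeffs (RatField p) s K H :=
  fun k h => Matrix.of fun a b =>
    algebraMap (MvPolynomial (Fin p) ℝ) (RatField p) (num k h a b) /
      algebraMap (MvPolynomial (Fin p) ℝ) (RatField p) (den k h a b)

/-- The coefficients `A_{kh}(θ) = num(θ) / den(θ)` at the parameter value `θ`. -/
def coeffsAt (num den : Coeffs (MvPolynomial (Fin p) ℝ) s K H) (θ : Fin p → ℝ) :
    Coeffs ℝ s K H :=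
  fun k h => Matrix.of fun a b =>
    MvPolynomial.eval θ (num k h a b) / MvPolynomial.eval θ (den k h a b)

/-- The value at `θ` of a rational function (in lowest terms); only used off the poles. -/
def ratEval (θ : Fin p → ℝ) (x : RatField p) : ℝ :=
  MvPolynomial.eval θ (IsFractionRing.num (MvPolynomial (Fin p) ℝ) x) /
    MvPolynomial.eval θ (IsFractionRing.den (MvPolynomial (Fin p) ℝ) x : MvPolynomial (Fin p) ℝ)

/-- Evaluation at `θ` of the coefficients of a polynomial in `z`. -/
def polyAt (θ : Fin p → ℝ) (f : (RatField p)[X]) : ℝ[X] :=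
  ∑ n ∈ f.support, monomial n (ratEval θ (f.coeff n))

end Parameters

/-! ### Processes

Scalar random variables are vectors of a real Hilbert space `E` (later `E = L²(Ω)`), the inner
product being the second moment; an `n`-dimensional process is a map `ℤ → Fin n → E`. -/

section Processes

variable {E : Type*} [NormedAddCommGroup E] [InnerProductSpace ℝ E]
variable {s q K H : ℕ}

/-- `H_u(t)`: the closed linear span of the components of `u_t, u_{t-1}, …`. -/
def info (u : ℤ → Fin s → E) (t : ℤ) : Submodule ℝ E :=
  (Submodule.span ℝ {x | ∃ (j : ℕ) (i : Fin s), x = u (t - j) i}).topologicalClosure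

/-- `E_t`: the orthogonal projection onto `H_u(t)`. -/
def condExp [CompleteSpace E] (u : ℤ → Fin s → E) (t : ℤ) (x : E) : E :=
  haveI : CompleteSpace (info u t) :=
    (Submodule.isClosed_topologicalClosure _).completeSpace_coe
  (info u t).starProjection x

/-- `(M(z) x)_t` for a matrix polynomial `M` in the backward shift `z`. -/
def lagApply {m n : ℕ} (M : Matrix (Fin m) (Fin n) ℝ[X]) (x : ℤ → Fin n → E) :
    ℤ → Fin m → E :=
  fun t a => ∑ b, (M a b).sum fun l c => c • x (t - l) b

/-- `x_t = ∑_{j ≥ 0} c_j ε_{t-j}` for all `t`, with mean-square convergence. -/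
def IsMovingAverage (ε : ℤ → Fin q → E) (c : ℕ → Matrix (Fin s) (Fin q) ℝ)
    (x : ℤ → Fin s → E) : Prop :=
  ∀ t a, HasSum (fun j : ℕ => ∑ b, c j a b • ε (t - j) b) (x t a)

/-- `u_t = ∑_j w_j ε_{t-j}` is a Wold representation of `u`: `ε` is `q`-dimensional white noise
with covariance matrix of rank `q`, and `ε_t` lies in the present and past of `u`. -/
structure IsWold (u : ℤ → Fin s → E) (ε : ℤ → Fin q → E)
    (w : ℕ → Matrix (Fin s) (Fin q) ℝ) : Prop where
  white : ∃ Sig : Matrix (Fin q) (Fin q) ℝ, Sig.rank = q ∧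
    ∀ t t' a b, inner ℝ (ε t a) (ε t' b) = if t = t' then Sig a b else 0
  innovation : ∀ t b, ε t b ∈ info u t
  summable : ∀ a b, Summable fun j => (w j * (w j).transpose) a b
  repr : IsMovingAverage ε w u

/-- Causal stationary processes: `y_t = ∑_{j ≥ 0} c_j ε_{t-j}` with constant matrices `c_j`. -/
def IsCausalStationary (ε : ℤ → Fin q → E) (y : ℤ → Fin s → E) : Prop :=
  ∃ c : ℕ → Matrix (Fin s) (Fin q) ℝ, IsMovingAverage ε c y

/-- `y` solves the RE model: `y_t ∈ H_u(t)` and `∑_k ∑_h A_{kh} E_{t-k}(y_{t+h-k}) = -u_t`. -/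
def IsRESolution [CompleteSpace E] (A : Coeffs ℝ s K H) (u y : ℤ → Fin s → E) : Prop :=
  (∀ t a, y t a ∈ info u t) ∧
    ∀ t a, ∑ k : Fin (K + 1), ∑ h : Fin (H + 1), ∑ b,
      A k h a b • condExp u (t - ((k : ℕ) : ℤ)) (y (t + ((h : ℕ) : ℤ) - ((k : ℕ) : ℤ)) b) = -u t a

/-- `H` processes `ε^0, …, ε^{H-1}` of dimension `s` that are martingale differences with respect
to `H_u(t)`. -/
def IsMDS [CompleteSpace E] (u : ℤ → Fin s → E) (e : Fin H → ℤ → Fin s → E) : Prop :=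
  ∀ j t a, condExp u t (e j t a) = e j t a ∧ condExp u (t - 1) (e j t a) = 0

/-- `ζ_t = -∑_k ∑_{j<H} ∑_{h≤j} A_{kh} ε^j_{t-(k+j-h)}`. -/
def zeta (A : Coeffs ℝ s K H) (e : Fin H → ℤ → Fin s → E) : ℤ → Fin s → E :=
  fun t a => -∑ k : Fin (K + 1), ∑ j : Fin H, ∑ h : Fin (H + 1),
    if (h : ℕ) ≤ (j : ℕ) then
      ∑ b, A k h a b • e j (t - (((k : ℕ) : ℤ) + (((j : ℕ) : ℤ) - ((h : ℕ) : ℤ)))) b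
    else 0

/-- The structural difference equation
`π(z) y_t = π(z) (ε^0_t + ε^1_{t-1} + ⋯ + ε^{H-1}_{t-H+1}) + ζ_{t-J₁} - u_{t-J₁}`. -/
def IsSDESolution (A : Coeffs ℝ s K H) (u : ℤ → Fin s → E) (e : Fin H → ℤ → Fin s → E)
    (y : ℤ → Fin s → E) : Prop :=
  ∀ t a, lagApply (piPoly A) y t a =
    lagApply (piPoly A) (fun t b => ∑ j : Fin H, e j (t - ((j : ℕ) : ℤ)) b) t a
      + zeta A e (t - J1 A) a - u (t - J1 A) a

/-- The constraints
`C (ε^0_t, …, ε^{H-1}_t) = D ((E_t - E_{t-1}) u_t, …, (E_t - E_{t-1}) u_{t+H-J₁+g_s-1})`. -/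
def Constraints [CompleteSpace E] {A : Coeffs ℝ s K H} (S : SmithForm (piPoly A))
    (u : ℤ → Fin s → E) (e : Fin H → ℤ → Fin s → E) : Prop :=
  ∀ t ik, ∑ jb : Fin H × Fin s, Cmat S ik jb • e jb.1 t jb.2 =
    ∑ nb : Fin (numLeads S) × Fin s, Dmat S ik nb •
      (condExp u t (u (t + ((nb.1 : ℕ) : ℤ)) nb.2)
        - condExp u (t - 1) (u (t + ((nb.1 : ℕ) : ℤ)) nb.2))

/-- The martingale differences `ε^j_t = h_j ε_t`, the matrix `η` stacking `h_0, …, h_{H-1}`. -/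
def mds (ε : ℤ → Fin q → E) (η : Matrix (Fin H × Fin s) (Fin q) ℝ) :
    Fin H → ℤ → Fin s → E :=
  fun j t a => ∑ b, η (j, a) b • ε t b

/-- The admissible values of the parameters `h_0, …, h_{H-1}` of the structural difference
equation: those for which the martingale differences `h_j ε_t` satisfy the constraints. -/
def freeParams [CompleteSpace E] {A : Coeffs ℝ s K H} (S : SmithForm (piPoly A))
    (u : ℤ → Fin s → E) (ε : ℤ → Fin q → E) : Set (Matrix (Fin H × Fin s) (Fin q) ℝ) :=
  {η | Constraints S u (mds ε η)}

/-- The forcing term `α(z)⁻¹ P(z)⁻¹ (ζ_{t-J₁} - u_{t-J₁})` does not look into the future. -/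
def CausalForcing {A : Coeffs ℝ s K H} (S : SmithForm (piPoly A))
    (u : ℤ → Fin s → E) (e : Fin H → ℤ → Fin s → E) : Prop :=
  ∀ t k, lagApply S.P⁻¹ (fun t a => zeta A e t a - u t a)
    (t + ((S.g k : ℕ) : ℤ) - J1 A) k ∈ info u t

/-- All non-zero zeros of `det π` lie outside the closed unit disc. -/
def NonzeroZerosOutside (A : Coeffs ℝ s K H) : Prop :=
  ∀ z : ℂ, z ≠ 0 → aeval z (piPoly A).det = 0 → 1 < ‖z‖

end Processes

end RE

end

/-!
For a process `y`, the *revisions* `(E_t - E_{t-1}) y_{t+j}`, `0 ≤ j < H`, measure the news about its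
future. A forecast error is a sum of revisions (`proj_eq_sub_sum_rev`), so an adapted `y` solves the
rational expectations model iff it solves the structural difference equation driven by its own
revisions (`isRESolution_iff_revisions`). The constraints express exactly that the martingale
differences in that equation are the revisions of the solution (`constraints_iff_eq_revisions`): with
`x_t = y_t - ε^0_t - ⋯ - ε^{H-1}_{t-H+1}` and `ψ = ζ - u`, the equation reads `π(z) x_t = ψ_{t-J₁}`,
and the Smith form turns it into `Φ(z) Q(z) x_t = α(z)⁻¹ P(z)⁻¹ ψ_{t-J₁}`. Since `Φ(0) Q(0)` is
invertible, `x_t, …, x_{t+H-1}` are not revised at time `t` iff the right-hand sides at leads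
`0, …, H-1` are not revised, and this is the system of equations with the matrices `C` and `D`.

Processes `∑_j c_j ε_{t-j}` with constant coefficients are precisely those which are adapted and whose
second moments with `ε` are shift invariant (`IsWold.isCausalStationary_iff`), a description which is
stable under polynomials and absolutely summable filters in the shift. The revisions of such a process
are constant multiples of `ε_t`, so the constraints become the linear system `C η = D W`, whose
solution set has dimension `(Hs - rank C) q`, and the parameters can be read off from a solution. If
the zeros of `Φ` lie outside the closed unit disc, `Φ(z)` is inverted by an absolutely summable filter
(`exists_summable_inverse`), so that a causal stationary solution exists iff
`α(z)⁻¹ P(z)⁻¹ ψ_{t-J₁}` is adapted (`IsWold.existsUnique_solution_iff`); uniqueness holds because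
the difference of two solutions is never revised.

All this holds at every parameter value at which the coefficients are defined and `π` has a Smith
form. Genericity only enters in showing that regularity, `J₁`, the Smith form and the rank of `C`
persist away from the zeros of a polynomial (`eventually_smithForm`): evaluation at `θ` is a ring
homomorphism on the rational functions defined at `θ`, and only finitely many of those occur.
-/

namespace RE

/-! ### Polynomials in the backward shift -/

section Lag

variable {E : Type*} [NormedAddCommGroup E] [InnerProductSpace ℝ E]

/-- The backward shift `(z x)_t = x_{t-1}` on scalar processes. -/
def lag (E : Type*) [NormedAddCommGroup E] [InnerProductSpace ℝ E] : Module.End ℝ (ℤ → E) where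
  toFun x t := x (t - 1)
  map_add' _ _ := rfl
  map_smul' _ _ := rfl

lemma lag_pow_apply (n : ℕ) (x : ℤ → E) (t : ℤ) : (lag E ^ n) x t = x (t - n) := by
  induction n generalizing x with
  | zero => simp
  | succ n ih =>
    rw [pow_succ, Module.End.mul_apply, ih]
    change x (t - n - 1) = _
    congr 1; push_cast; ring

lemma aeval_lag_apply (p : ℝ[X]) (x : ℤ → E) (t : ℤ) :
    aeval (lag E) p x t = p.sum fun l c => c • x (t - l) := by
  rw [aeval_eq_sum_range, sum_over_range _ (by simp)]
  simp [LinearMap.sum_apply, Finset.sum_apply, lag_pow_apply]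

lemma lagApply_eq_aeval {m n : ℕ} (M : Matrix (Fin m) (Fin n) ℝ[X]) (x : ℤ → Fin n → E) (t : ℤ)
    (a : Fin m) : lagApply M x t a = ∑ b, aeval (lag E) (M a b) (fun t => x t b) t := by
  simp [lagApply, aeval_lag_apply]

lemma lagApply_mul {l m n : ℕ} (M : Matrix (Fin l) (Fin m) ℝ[X]) (N : Matrix (Fin m) (Fin n) ℝ[X])
    (x : ℤ → Fin n → E) : lagApply (M * N) x = lagApply M (lagApply N x) := by
  ext t a
  have h : ∀ b, (fun t => lagApply N x t b) =
      ∑ c, aeval (lag E) (N b c) (fun t => x t c) := fun b => by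
    ext t; rw [lagApply_eq_aeval, Finset.sum_apply]
  simp only [lagApply_eq_aeval M, h, lagApply_eq_aeval (M * N), Matrix.mul_apply, map_sum, map_mul,
    LinearMap.sum_apply, Finset.sum_apply, Module.End.mul_apply]
  exact Finset.sum_comm

lemma lagApply_diagonal {n : ℕ} (d : Fin n → ℝ[X]) (x : ℤ → Fin n → E) (t : ℤ) (a : Fin n) :
    lagApply (Matrix.diagonal d) x t a = aeval (lag E) (d a) (fun t => x t a) t := by
  rw [lagApply_eq_aeval, Finset.sum_eq_single a]
  · simp
  · intro b _ hb; simp [Matrix.diagonal_apply_ne' _ hb]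
  · simp

lemma lagApply_one {n : ℕ} (x : ℤ → Fin n → E) : lagApply 1 x = x := by
  ext t a
  rw [← Matrix.diagonal_one, lagApply_diagonal]
  simp

lemma lagApply_diagonal_X_pow {n : ℕ} (g : Fin n → ℕ) (x : ℤ → Fin n → E) (t : ℤ) (a : Fin n) :
    lagApply (Matrix.diagonal fun i => (X : ℝ[X]) ^ g i) x t a = x (t - g a) a := by
  rw [lagApply_diagonal, map_pow, aeval_X, lag_pow_apply]

lemma lagApply_sub {m n : ℕ} (M : Matrix (Fin m) (Fin n) ℝ[X]) (x y : ℤ → Fin n → E) (t : ℤ)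
    (a : Fin m) :
    lagApply M (fun t b => x t b - y t b) t a = lagApply M x t a - lagApply M y t a := by
  simp only [lagApply_eq_aeval, ← Finset.sum_sub_distrib]
  refine Finset.sum_congr rfl fun b _ => ?_
  rw [← Pi.sub_apply, ← map_sub]; rfl

lemma lagApply_shift {m n : ℕ} (M : Matrix (Fin m) (Fin n) ℝ[X]) (x : ℤ → Fin n → E) (t d : ℤ)
    (a : Fin m) : lagApply M (fun t => x (t + d)) t a = lagApply M x (t + d) a := by
  unfold lagApply
  refine Finset.sum_congr rfl fun b _ => ?_
  congr 1; ext l c; beta_reduce; rw [show t - (l : ℤ) + d = t + d - l by ring]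

/-- Linear maps, applied componentwise, commute with polynomials in the shift. -/
lemma map_lagApply {F : Type*} [NormedAddCommGroup F] [InnerProductSpace ℝ F] {m n : ℕ}
    (L : E →ₗ[ℝ] F) (M : Matrix (Fin m) (Fin n) ℝ[X]) (x : ℤ → Fin n → E) (t : ℤ) (a : Fin m) :
    L (lagApply M x t a) = lagApply M (fun t b => L (x t b)) t a := by
  simp [lagApply, Polynomial.sum]

lemma lagApply_mem {m n : ℕ} (M : Matrix (Fin m) (Fin n) ℝ[X]) {x : ℤ → Fin n → E} {t : ℤ}
    {V : Submodule ℝ E} (h : ∀ s ≤ t, ∀ b, x s b ∈ V) (a : Fin m) : lagApply M x t a ∈ V :=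
  Submodule.sum_mem _ fun b _ => Submodule.sum_mem _ fun l _ =>
    V.smul_mem _ (h _ (by omega) _)

end Lag

/-! ### Projections and revisions -/

section Projections

variable {E : Type*} [NormedAddCommGroup E] [InnerProductSpace ℝ E] {s q H : ℕ}

lemma info_mono (u : ℤ → Fin s → E) {t t' : ℤ} (h : t ≤ t') : info u t ≤ info u t' := by
  refine Submodule.topologicalClosure_mono (Submodule.span_mono ?_)
  rintro x ⟨j, i, rfl⟩
  exact ⟨j + (t' - t).toNat, i, by congr 1; push_cast; omega⟩

lemma self_mem_info (u : ℤ → Fin s → E) (t : ℤ) (a : Fin s) : u t a ∈ info u t :=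
  Submodule.le_topologicalClosure _ (Submodule.subset_span ⟨0, a, by simp⟩)

lemma isClosed_info (u : ℤ → Fin s → E) (t : ℤ) : IsClosed (info u t : Set E) :=
  Submodule.isClosed_topologicalClosure _

variable [CompleteSpace E]

instance completeSpace_info (u : ℤ → Fin s → E) (t : ℤ) : CompleteSpace (info u t) :=
  (isClosed_info u t).completeSpace_coe

/-- The projection `E_t` as a continuous linear map. -/
noncomputable def proj (u : ℤ → Fin s → E) (t : ℤ) : E →L[ℝ] E := (info u t).starProjection

lemma condExp_eq_proj (u : ℤ → Fin s → E) (t : ℤ) (x : E) : condExp u t x = proj u t x := rfl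

lemma proj_of_mem {u : ℤ → Fin s → E} {t : ℤ} {x : E} (h : x ∈ info u t) : proj u t x = x :=
  Submodule.starProjection_eq_self_iff.2 h

lemma proj_mem (u : ℤ → Fin s → E) (t : ℤ) (x : E) : proj u t x ∈ info u t :=
  Submodule.starProjection_apply_mem _ _

lemma mem_of_proj_eq {u : ℤ → Fin s → E} {t : ℤ} {x : E} (h : proj u t x = x) : x ∈ info u t :=
  h ▸ proj_mem u t x

lemma proj_proj {u : ℤ → Fin s → E} {t t' : ℤ} (h : t ≤ t') (x : E) :
    proj u t (proj u t' x) = proj u t x := by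
  have := Submodule.starProjection_comp_starProjection_of_le (info_mono u h)
  exact congrArg (fun f : E →L[ℝ] E => f x) this

lemma proj_eq_zero_of_orthogonal {u : ℤ → Fin s → E} {t : ℤ} {x : E}
    (h : ∀ y ∈ info u t, inner ℝ y x = 0) : proj u t x = 0 :=
  (Submodule.starProjection_apply_eq_zero_iff _).2 ((Submodule.mem_orthogonal _ _).2 h)

/-- The revision `E_t - E_{t-1}` of expectations at time `t`. -/
noncomputable def rev (u : ℤ → Fin s → E) (t : ℤ) : E →L[ℝ] E := proj u t - proj u (t - 1)

lemma rev_apply (u : ℤ → Fin s → E) (t : ℤ) (x : E) :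
    rev u t x = proj u t x - proj u (t - 1) x := rfl

lemma rev_of_mem {u : ℤ → Fin s → E} {t t' : ℤ} {x : E} (h : x ∈ info u t') (h' : t' < t) :
    rev u t x = 0 := by
  rw [rev_apply, proj_of_mem (info_mono u h'.le h), proj_of_mem (info_mono u (by omega) h),
    sub_self]

lemma rev_mem (u : ℤ → Fin s → E) (t : ℤ) (x : E) : rev u t x ∈ info u t :=
  Submodule.sub_mem _ (proj_mem _ _ _) (info_mono u (by omega) (proj_mem _ _ _))

/-- Innovations at time `t'` are only revised at time `t'`. -/
lemma rev_of_innovation {u : ℤ → Fin s → E} {t t' : ℤ} {x : E} (h : proj u t' x = x)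
    (h' : proj u (t' - 1) x = 0) : rev u t x = if t = t' then x else 0 := by
  have hlt : ∀ r < t', proj u r x = 0 := fun r hr => by
    rw [← proj_proj (show r ≤ t' - 1 by omega), h', map_zero]
  split_ifs with htt
  · subst htt; rw [rev_apply, h, h', sub_zero]
  · rcases lt_or_gt_of_ne htt with hlt' | hgt
    · rw [rev_apply, hlt _ hlt', hlt _ (by omega), sub_zero]
    · exact rev_of_mem (mem_of_proj_eq h) hgt

lemma proj_sub_one_rev (u : ℤ → Fin s → E) (t : ℤ) (x : E) : proj u (t - 1) (rev u t x) = 0 := by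
  rw [rev_apply, map_sub, proj_proj (by omega), proj_proj le_rfl, sub_self]

lemma IsMDS.rev_eq {u : ℤ → Fin s → E} {e : Fin H → ℤ → Fin s → E} (he : IsMDS u e) (j : Fin H)
    (t t' : ℤ) (a : Fin s) : rev u t (e j t' a) = if t = t' then e j t' a else 0 :=
  rev_of_innovation (he j t' a).1 (he j t' a).2

lemma IsMDS.mem {u : ℤ → Fin s → E} {e : Fin H → ℤ → Fin s → E} (he : IsMDS u e) (j : Fin H)
    (t : ℤ) (a : Fin s) : e j t a ∈ info u t := mem_of_proj_eq (he j t a).1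

/-- The revision processes `ε^j_t = (E_t - E_{t-1}) y_{t+j}` of `y`. -/
noncomputable def revisions (H : ℕ) (u y : ℤ → Fin s → E) : Fin H → ℤ → Fin s → E :=
  fun j t a => rev u t (y (t + ((j : ℕ) : ℤ)) a)

lemma isMDS_revisions (u y : ℤ → Fin s → E) : IsMDS u (revisions H u y) := fun _ _ _ =>
  ⟨proj_of_mem (rev_mem _ _ _), proj_sub_one_rev _ _ _⟩

/-- The forecast error of `y_{t+h}` is the sum of the revisions at times `t+1, …, t+h`. -/
lemma proj_eq_sub_sum_rev {u : ℤ → Fin s → E} {t : ℤ} {h : ℕ} {x : E} (hx : x ∈ info u (t + h)) :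
    proj u t x = x - ∑ j ∈ Finset.range h, rev u (t + h - j) x := by
  have key : ∀ n : ℕ, proj u (t + h - n) x =
      x - ∑ j ∈ Finset.range n, rev u (t + h - j) x := by
    intro n
    induction n with
    | zero => simpa using proj_of_mem hx
    | succ n ih =>
      rw [Finset.sum_range_succ, ← sub_sub, ← ih, rev_apply, sub_sub_cancel]
      congr 2; push_cast; ring
  have := key h
  rwa [add_sub_cancel_right] at this

end Projections

/-! ### The model written in terms of revisions -/

section Revisions

variable {E : Type*} [NormedAddCommGroup E] [InnerProductSpace ℝ E] {s q K H : ℕ}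

lemma Astar_ne_zero_bounds {F : Type*} [Field F] {A : Coeffs F s K H} {i : ℤ}
    (hi : Astar A i ≠ 0) : -(K : ℤ) ≤ i ∧ i ≤ H := by
  contrapose! hi
  refine Finset.sum_eq_zero fun k _ => Finset.sum_eq_zero fun h _ => if_neg ?_
  intro hkh
  have := k.2; have := h.2
  have := hi (by omega)
  omega

lemma Astar_eq_zero_of_notMem {F : Type*} [Field F] {A : Coeffs F s K H} {i : ℤ}
    (hi : i ∉ Finset.Icc (J0 A) (J1 A)) : Astar A i = 0 := by
  by_contra h
  refine hi (Finset.mem_Icc.2 ⟨csInf_le ⟨-(K : ℤ), fun j hj => ?_⟩ h,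
    le_csSup ⟨(H : ℤ), fun j hj => ?_⟩ h⟩)
  · exact (Astar_ne_zero_bounds hj).1
  · exact (Astar_ne_zero_bounds hj).2

/-- `∑_{k,h} A_{kh} y_{t+h-k} = π(z) y_{t+J₁}`. -/
lemma sum_coeff_smul_eq_lagApply (A : Coeffs ℝ s K H) (y : ℤ → Fin s → E) (t : ℤ) (a : Fin s) :
    ∑ k : Fin (K + 1), ∑ h : Fin (H + 1), ∑ b,
      A k h a b • y (t + ((h : ℕ) : ℤ) - ((k : ℕ) : ℤ)) b =
    lagApply (piPoly A) y (t + J1 A) a := by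
  have hpi : lagApply (piPoly A) y (t + J1 A) a =
      ∑ i ∈ Finset.Icc (J0 A) (J1 A), ∑ b, Astar A i a b • y (t + i) b := by
    rw [lagApply_eq_aeval, Finset.sum_comm]
    refine Finset.sum_congr rfl fun b _ => ?_
    simp only [piPoly, Matrix.sum_apply, Matrix.map_apply, map_sum, LinearMap.sum_apply,
      Finset.sum_apply]
    refine Finset.sum_congr rfl fun i hi => ?_
    have := (Finset.mem_Icc.1 hi).2
    rw [aeval_lag_apply, sum_monomial_index _ _ (by simp)]
    congr 2; omega
  -- Enlarge the range of summation so that it contains every difference `h - k`.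
  let I : Finset ℤ := Finset.Icc (J0 A) (J1 A) ∪ Finset.Icc (-(K : ℤ)) H
  rw [hpi, Finset.sum_subset (Finset.subset_union_left : _ ⊆ I)
    fun i _ hi => by simp [Astar_eq_zero_of_notMem hi]]
  have hA : ∀ i b, Astar A i a b • y (t + i) b = ∑ k : Fin (K + 1), ∑ h : Fin (H + 1),
      if ((h : ℕ) : ℤ) - ((k : ℕ) : ℤ) = i then
        A k h a b • y (t + ((h : ℕ) : ℤ) - ((k : ℕ) : ℤ)) b else 0 := by
    intro i b
    simp only [Astar, Matrix.sum_apply, Finset.sum_smul]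
    refine Finset.sum_congr rfl fun k _ => Finset.sum_congr rfl fun h _ => ?_
    split_ifs with hi
    · rw [← hi, add_sub_assoc]
    · simp
  have hI : ∀ b, ∑ i ∈ I, Astar A i a b • y (t + i) b = ∑ k : Fin (K + 1), ∑ h : Fin (H + 1),
      A k h a b • y (t + ((h : ℕ) : ℤ) - ((k : ℕ) : ℤ)) b := by
    intro b
    simp only [hA]
    rw [Finset.sum_comm]
    refine Finset.sum_congr rfl fun k _ => ?_
    rw [Finset.sum_comm]
    refine Finset.sum_congr rfl fun h _ => ?_
    rw [Finset.sum_ite_eq, if_pos]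
    refine Finset.mem_union_right _ (Finset.mem_Icc.2 ?_)
    have := k.2; have := h.2
    omega
  rw [Finset.sum_comm (s := I)]
  simp only [hI]
  rw [Finset.sum_comm (s := (Finset.univ : Finset (Fin s)))]
  exact Finset.sum_congr rfl fun k _ => Finset.sum_comm

/-- The forecast errors that enter the model, in terms of `π` and `ζ`. -/
lemma sum_coeff_smul_forecast_error (A : Coeffs ℝ s K H) (e : Fin H → ℤ → Fin s → E) (t : ℤ)
    (a : Fin s) :
    ∑ k : Fin (K + 1), ∑ h : Fin (H + 1), ∑ b, A k h a b • (∑ j : Fin H,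
      if (j : ℕ) < (h : ℕ) then
        e j (t + ((h : ℕ) : ℤ) - ((k : ℕ) : ℤ) - ((j : ℕ) : ℤ)) b else 0) =
    lagApply (piPoly A) (fun t b => ∑ j : Fin H, e j (t - ((j : ℕ) : ℤ)) b) (t + J1 A) a
      + zeta A e t a := by
  rw [← sum_coeff_smul_eq_lagApply, zeta, ← sub_eq_add_neg, ← Finset.sum_sub_distrib]
  refine Finset.sum_congr rfl fun k _ => ?_
  rw [Finset.sum_comm (s := (Finset.univ : Finset (Fin H))), ← Finset.sum_sub_distrib]
  refine Finset.sum_congr rfl fun h _ => ?_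
  have : ∀ j : Fin H, (if (h : ℕ) ≤ (j : ℕ) then
      ∑ b, A k h a b • e j (t - (((k : ℕ) : ℤ) + (((j : ℕ) : ℤ) - ((h : ℕ) : ℤ)))) b else 0) =
      ∑ b, A k h a b • (if (h : ℕ) ≤ (j : ℕ) then
        e j (t + ((h : ℕ) : ℤ) - ((k : ℕ) : ℤ) - ((j : ℕ) : ℤ)) b else 0) := by
    intro j
    split_ifs
    · refine Finset.sum_congr rfl fun b _ => ?_
      rw [show t - (((k : ℕ) : ℤ) + (((j : ℕ) : ℤ) - ((h : ℕ) : ℤ))) =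
        t + ((h : ℕ) : ℤ) - ((k : ℕ) : ℤ) - ((j : ℕ) : ℤ) by ring]
    · simp
  simp only [this]
  rw [Finset.sum_comm, ← Finset.sum_sub_distrib]
  refine Finset.sum_congr rfl fun b _ => ?_
  rw [← Finset.smul_sum, ← smul_sub, ← Finset.sum_sub_distrib]
  congr 1
  refine Finset.sum_congr rfl fun j _ => ?_
  by_cases hj : (j : ℕ) < (h : ℕ)
  · simp [hj, not_le.2 hj]
  · simp [hj, not_lt.1 hj]

variable [CompleteSpace E]

/-- An adapted process solves the model iff it solves the structural difference equation driven by
its own revisions. -/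
theorem isRESolution_iff_revisions (A : Coeffs ℝ s K H) {u y : ℤ → Fin s → E}
    (hy : ∀ t a, y t a ∈ info u t) :
    IsRESolution A u y ↔ IsSDESolution A u (revisions H u y) y := by
  have key : ∀ t a, ∑ k : Fin (K + 1), ∑ h : Fin (H + 1), ∑ b,
      A k h a b • condExp u (t - ((k : ℕ) : ℤ)) (y (t + ((h : ℕ) : ℤ) - ((k : ℕ) : ℤ)) b) =
      lagApply (piPoly A) y (t + J1 A) a -
      (lagApply (piPoly A) (fun t b => ∑ j : Fin H, revisions H u y j (t - ((j : ℕ) : ℤ)) b)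
        (t + J1 A) a + zeta A (revisions H u y) t a) := by
    intro t a
    rw [← sum_coeff_smul_forecast_error, ← sum_coeff_smul_eq_lagApply]
    simp only [← Finset.sum_sub_distrib, ← smul_sub]
    refine Finset.sum_congr rfl fun k _ => Finset.sum_congr rfl fun h _ =>
      Finset.sum_congr rfl fun b _ => ?_
    have hmem := hy (t - ((k : ℕ) : ℤ) + ((h : ℕ) : ℤ)) b
    rw [condExp_eq_proj, show t + ((h : ℕ) : ℤ) - ((k : ℕ) : ℤ) =
      t - ((k : ℕ) : ℤ) + ((h : ℕ) : ℤ) by ring, proj_eq_sub_sum_rev hmem]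
    congr 2
    have hh : (h : ℕ) ≤ H := Nat.lt_succ_iff.1 h.2
    have hre : ∀ (τ : ℤ) (j : Fin H), revisions H u y j (τ - ((j : ℕ) : ℤ)) b =
        rev u (τ - ((j : ℕ) : ℤ)) (y τ b) := fun τ j => by
      rw [revisions, sub_add_cancel]
    simp only [hre]
    rw [Fin.sum_univ_eq_sum_range (fun j => if j < (h : ℕ) then
      rev u (t - ((k : ℕ) : ℤ) + ((h : ℕ) : ℤ) - (j : ℤ))
        (y (t - ((k : ℕ) : ℤ) + ((h : ℕ) : ℤ)) b) else 0) H, ← Finset.sum_filter]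
    refine Finset.sum_congr ?_ fun _ _ => rfl
    ext j; simp only [Finset.mem_range, Finset.mem_filter]; omega
  simp only [IsRESolution, key, IsSDESolution]
  refine ⟨fun h t a => ?_, fun h => ⟨hy, fun t a => ?_⟩⟩
  · have := h.2 (t - J1 A) a
    rw [sub_add_cancel] at this
    rw [sub_eq_iff_eq_add] at this
    rw [this]; abel
  · have := h (t + J1 A) a
    rw [add_sub_cancel_right] at this
    rw [this]; abel

end Revisions

/-! ### The constraints characterise the revisions -/

section ConstraintsAsRevisions

variable {E : Type*} [NormedAddCommGroup E] [InnerProductSpace ℝ E] {s K H : ℕ}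

lemma eq_zero_of_sum_smul_eq_zero {n : ℕ} {N : Matrix (Fin n) (Fin n) ℝ} (hN : N.det ≠ 0)
    {v : Fin n → E} (h : ∀ a, ∑ b, N a b • v b = 0) (c : Fin n) : v c = 0 := by
  have h1 : ∑ a, N⁻¹ c a • ∑ b, N a b • v b = v c := by
    simp only [Finset.smul_sum, smul_smul]
    rw [Finset.sum_comm]
    simp only [← Finset.sum_smul, ← Matrix.mul_apply, Matrix.nonsing_inv_mul N hN.isUnit]
    simp [Matrix.one_apply]
  rw [← h1]; simp [h]

/-- Reindexing by the lead `n = c - l` instead of the lag `l`; as `G` vanishes at negative leads, all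
that remains is the range `0 ≤ n < N` of the columns of `D`. -/
lemma sum_smul_shift (p : ℝ[X]) {G : ℤ → E} (hG : ∀ n < 0, G n = 0) {c : ℤ} {N : ℕ}
    (hc : c < N) :
    (p.sum fun l r => r • G (c - l)) =
      ∑ n : Fin N, (if 0 ≤ c - ((n : ℕ) : ℤ) then p.coeff (c - ((n : ℕ) : ℤ)).toNat else 0) •
        G ((n : ℕ) : ℤ) := by
  induction p using Polynomial.induction_on' with
  | add p r hp hr =>
    rw [sum_add_index _ _ _ (by simp) (by simp [add_smul]), hp, hr, ← Finset.sum_add_distrib]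
    refine Finset.sum_congr rfl fun n _ => ?_
    split_ifs <;> simp [add_smul]
  | monomial l r =>
    rw [sum_monomial_index _ _ (by simp)]
    by_cases hl : 0 ≤ c - l
    · rw [Finset.sum_eq_single ⟨(c - l).toNat, by omega⟩]
      · have h1 : (((c - l).toNat : ℕ) : ℤ) = c - l := Int.toNat_of_nonneg hl
        simp only [h1, sub_sub_cancel, Int.natCast_nonneg, if_true, Int.toNat_natCast,
          coeff_monomial]
      · intro n _ hn
        split_ifs with h0
        · rw [coeff_monomial, if_neg, zero_smul]
          intro h; apply hn; ext; simp only; omega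
        · simp
      · simp
    · rw [hG _ (not_le.1 hl), smul_zero, Finset.sum_eq_zero]
      intro n _
      split_ifs with h0
      · rw [coeff_monomial, if_neg (by omega), zero_smul]
      · simp

lemma SmithForm.det_coeff_zero_ne_zero {M : Matrix (Fin s) (Fin s) ℝ[X]} (S : SmithForm M) :
    ((Matrix.diagonal S.φ * S.Q).map fun f => f.coeff 0).det ≠ 0 := by
  have h1 : ((Matrix.diagonal S.φ * S.Q).map fun f => f.coeff 0).det =
      constantCoeff (Matrix.diagonal S.φ * S.Q).det := by
    rw [RingHom.map_det]; rfl
  rw [h1, Matrix.det_mul, map_mul, Matrix.det_diagonal, map_prod]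
  refine mul_ne_zero (Finset.prod_ne_zero_iff.2 fun i _ => S.φ_zero i) ?_
  exact ((S.isUnit_det_Q).map constantCoeff).ne_zero

/-- The equation solved for `Φ(z) Q(z) x`, where `x` is the part of a solution that is not
accounted for by the martingale differences. -/
lemma lagApply_phi_mul_Q {A : Coeffs ℝ s K H} (S : SmithForm (piPoly A)) {x ψ : ℤ → Fin s → E}
    (h : ∀ t a, lagApply (piPoly A) x t a = ψ (t - J1 A) a) (t : ℤ) (k : Fin s) :
    lagApply (Matrix.diagonal S.φ * S.Q) x t k =
      lagApply S.P⁻¹ ψ (t + ((S.g k : ℕ) : ℤ) - J1 A) k := by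
  have h1 : lagApply S.P⁻¹ (lagApply (piPoly A) x) =
      lagApply (Matrix.diagonal fun i => (X : ℝ[X]) ^ S.g i)
        (lagApply (Matrix.diagonal S.φ * S.Q) x) := by
    rw [← lagApply_mul, ← lagApply_mul]
    congr 1
    have h0 := congrArg (S.P⁻¹ * ·) S.eq
    simpa only [Matrix.mul_assoc, Matrix.nonsing_inv_mul_cancel_left _ _ S.isUnit_det_P] using h0
  have h2 := congrFun (congrFun h1 (t + S.g k)) k
  rw [lagApply_diagonal_X_pow, add_sub_cancel_right] at h2
  rw [← h2]
  have h3 : lagApply (piPoly A) x = fun t => ψ (t + -J1 A) := by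
    ext t a; exact h t a
  rw [h3, lagApply_shift, ← sub_eq_add_neg]

lemma le_sup_g {A : Coeffs ℝ s K H} (S : SmithForm (piPoly A)) (k : Fin s) :
    S.g k ≤ Finset.univ.sup S.g := Finset.le_sup (Finset.mem_univ k)

variable [CompleteSpace E]

lemma rev_zeta {u : ℤ → Fin s → E} {e : Fin H → ℤ → Fin s → E} (he : IsMDS u e)
    (A : Coeffs ℝ s K H) (t : ℤ) (n : ℕ) (a : Fin s) :
    rev u t (zeta A e (t + n) a) = ∑ jb : Fin H × Fin s, zetaCoeff A n a jb • e jb.1 t jb.2 := by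
  have h1 : ∀ (k : Fin (K + 1)) (j : Fin H) (h : Fin (H + 1)),
      rev u t (if (h : ℕ) ≤ (j : ℕ) then ∑ b, A k h a b •
        e j (t + n - (((k : ℕ) : ℤ) + (((j : ℕ) : ℤ) - ((h : ℕ) : ℤ)))) b else 0) =
      ∑ b, (if (h : ℕ) ≤ (j : ℕ) ∧ (k : ℕ) + (j : ℕ) = n + (h : ℕ) then A k h a b else 0) •
        e j t b := by
    intro k j h
    by_cases hj : (h : ℕ) ≤ (j : ℕ)
    · simp only [hj, if_true, true_and, map_sum, map_smul, he.rev_eq]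
      refine Finset.sum_congr rfl fun b _ => ?_
      by_cases hk : (k : ℕ) + (j : ℕ) = n + (h : ℕ)
      · have ht : t + (n : ℤ) - (((k : ℕ) : ℤ) + (((j : ℕ) : ℤ) - ((h : ℕ) : ℤ))) = t := by omega
        simp [hk, ht]
      · rw [if_neg hk, if_neg (by omega)]; simp
    · simp [hj]
  simp only [zeta, map_neg, map_sum, h1, zetaCoeff, Matrix.of_apply, Fintype.sum_prod_type,
    neg_smul, Finset.sum_neg_distrib, Finset.sum_smul]
  congr 1
  rw [Finset.sum_comm]
  refine Finset.sum_congr rfl fun j _ => ?_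
  rw [Finset.sum_comm' (t' := Finset.univ) (s' := fun _ => Finset.univ) (by simp)]
  rw [Finset.sum_comm (s := (Finset.univ : Finset (Fin s)))]
  rw [Finset.sum_comm]
  refine Finset.sum_congr rfl fun k _ => ?_
  exact Finset.sum_comm

lemma zeta_mem {u : ℤ → Fin s → E} {e : Fin H → ℤ → Fin s → E} (he : IsMDS u e)
    (A : Coeffs ℝ s K H) (t : ℤ) (a : Fin s) : zeta A e t a ∈ info u t := by
  refine Submodule.neg_mem _ (Submodule.sum_mem _ fun k _ => Submodule.sum_mem _ fun j _ =>
    Submodule.sum_mem _ fun h _ => ?_)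
  split_ifs
  · exact Submodule.sum_mem _ fun b _ => Submodule.smul_mem _ _
      (info_mono u (by omega) (he.mem _ _ _))
  · exact Submodule.zero_mem _

/-- If `M(0)` is invertible, an adapted `x` and `M(z) x` are unpredictable at the same leads. -/
lemma rev_lagApply_eq_zero_iff {n : ℕ} {M : Matrix (Fin n) (Fin n) ℝ[X]}
    (hM : (M.map fun f => f.coeff 0).det ≠ 0) {u : ℤ → Fin s → E} {x : ℤ → Fin n → E}
    (hx : ∀ t a, x t a ∈ info u t) (t : ℤ) (m : ℕ) :
    (∀ i < m, ∀ a, rev u t (lagApply M x (t + i) a) = 0) ↔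
      ∀ i < m, ∀ a, rev u t (x (t + i) a) = 0 := by
  have hneg : ∀ r < t, ∀ a, rev u t (x r a) = 0 := fun r hr a => rev_of_mem (hx r a) hr
  have hcomm : ∀ i a, rev u t (lagApply M x i a) = lagApply M (fun t' b => rev u t (x t' b)) i a :=
    fun i a => map_lagApply (rev u t).toLinearMap M x i a
  constructor
  · intro h i
    induction i using Nat.strong_induction_on with
    | _ i ih =>
      intro hi
      refine eq_zero_of_sum_smul_eq_zero hM fun a => ?_
      rw [← h i hi a, hcomm, lagApply]
      refine Finset.sum_congr rfl fun b _ => ?_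
      rw [Polynomial.sum, Matrix.map_apply]
      by_cases h0 : (0 : ℕ) ∈ (M a b).support
      · rw [Finset.sum_eq_single_of_mem 0 h0]
        · simp
        · intro l _ hl
          by_cases hli : l ≤ i
          · rw [show t + (i : ℤ) - l = t + ((i - l : ℕ) : ℤ) by omega,
              ih (i - l) (by omega) (by omega), smul_zero]
          · rw [hneg _ (by omega), smul_zero]
      · rw [Polynomial.notMem_support_iff.1 h0, zero_smul, Finset.sum_eq_zero]
        intro l hl
        have hl0 : l ≠ 0 := fun h => h0 (h ▸ hl)
        by_cases hli : l ≤ i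
        · rw [show t + (i : ℤ) - l = t + ((i - l : ℕ) : ℤ) by omega,
            ih (i - l) (by omega) (by omega), smul_zero]
        · rw [hneg _ (by omega), smul_zero]
  · intro h i hi a
    rw [hcomm, lagApply]
    refine Finset.sum_eq_zero fun b _ => Finset.sum_eq_zero fun l _ => ?_
    beta_reduce
    by_cases hli : l ≤ i
    · rw [show t + (i : ℤ) - l = t + ((i - l : ℕ) : ℤ) by omega, h _ (by omega), smul_zero]
    · rw [hneg _ (by omega), smul_zero]

/-- The constraints say that the forcing term of `Φ(z) Q(z) x` is not revised at leads
`0, …, H-1`. -/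
lemma constraints_iff_rev_forcing {A : Coeffs ℝ s K H} (S : SmithForm (piPoly A))
    {u : ℤ → Fin s → E} {e : Fin H → ℤ → Fin s → E} (he : IsMDS u e) :
    Constraints S u e ↔ ∀ t, ∀ i < H, ∀ k, rev u t (lagApply S.P⁻¹
      (fun t a => zeta A e t a - u t a) (t + i + ((S.g k : ℕ) : ℤ) - J1 A) k) = 0 := by
  have key : ∀ (t : ℤ) (ik : Fin H × Fin s),
      rev u t (lagApply S.P⁻¹ (fun t a => zeta A e t a - u t a)
        (t + ((ik.1 : ℕ) : ℤ) + ((S.g ik.2 : ℕ) : ℤ) - J1 A) ik.2) =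
      ∑ jb : Fin H × Fin s, Cmat S ik jb • e jb.1 t jb.2 -
      ∑ nb : Fin (numLeads S) × Fin s, Dmat S ik nb •
      (condExp u t (u (t + ((nb.1 : ℕ) : ℤ)) nb.2)
        - condExp u (t - 1) (u (t + ((nb.1 : ℕ) : ℤ)) nb.2)) := by
    intro t ik
    have hC : ∑ jb : Fin H × Fin s, Cmat S ik jb • e jb.1 t jb.2 =
        ∑ nb : Fin (numLeads S) × Fin s, Dmat S ik nb •
          rev u t (zeta A e (t + ((nb.1 : ℕ) : ℤ)) nb.2) := by
      have h0 : ∀ jb, Cmat S ik jb = ∑ nb : Fin (numLeads S) × Fin s,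
          Dmat S ik nb * zetaCoeff A (nb.1 : ℕ) nb.2 jb := fun jb => Matrix.mul_apply
      simp only [h0, Finset.sum_smul, rev_zeta he, Finset.smul_sum, smul_smul]
      exact Finset.sum_comm
    rw [hC, ← Finset.sum_sub_distrib]
    simp only [condExp_eq_proj, ← rev_apply, ← smul_sub, ← map_sub]
    have h1 : ∀ τ, rev u t (lagApply S.P⁻¹ (fun t a => zeta A e t a - u t a) τ ik.2) =
        lagApply S.P⁻¹ (fun t' a => rev u t (zeta A e t' a - u t' a)) τ ik.2 := fun τ =>
      map_lagApply (rev u t).toLinearMap _ _ _ _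
    rw [h1, Fintype.sum_prod_type, Finset.sum_comm, lagApply]
    refine Finset.sum_congr rfl fun b _ => ?_
    have hlt : ((ik.1 : ℕ) : ℤ) + ((S.g ik.2 : ℕ) : ℤ) - J1 A < (numLeads S : ℕ) := by
      have := le_sup_g S ik.2
      have := ik.1.2
      have : ((H : ℤ) - J1 A + ((Finset.univ.sup S.g : ℕ) : ℤ)) ≤ numLeads S :=
        Int.self_le_toNat _
      omega
    have h2 := sum_smul_shift (S.P⁻¹ ik.2 b)
      (G := fun n => rev u t (zeta A e (t + n) b - u (t + n) b)) (fun n hn =>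
        rev_of_mem (Submodule.sub_mem _ (zeta_mem he A _ _) (self_mem_info u _ _)) (by omega)) hlt
    rw [show (Finset.univ.sum fun n : Fin (numLeads S) => Dmat S ik (n, b) •
      rev u t (zeta A e (t + ((n : ℕ) : ℤ)) b - u (t + ((n : ℕ) : ℤ)) b)) = _ from h2.symm]
    congr 1
    ext l c
    rw [show t + ((ik.1 : ℕ) : ℤ) + ((S.g ik.2 : ℕ) : ℤ) - J1 A - l =
      t + (((ik.1 : ℕ) : ℤ) + ((S.g ik.2 : ℕ) : ℤ) - J1 A - l) by ring]
  constructor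
  · intro h t i hi k
    have := key t (⟨i, hi⟩, k)
    rw [sub_eq_zero.2 (h t _)] at this
    exact this
  · intro h t ik
    rw [← sub_eq_zero, ← key]
    exact h t ik.1 ik.1.2 ik.2

/-- For an adapted solution of the structural difference equation, the constraints hold iff the
martingale differences are the revisions of the solution. -/
theorem constraints_iff_eq_revisions {A : Coeffs ℝ s K H} (S : SmithForm (piPoly A))
    {u y : ℤ → Fin s → E} {e : Fin H → ℤ → Fin s → E} (he : IsMDS u e)
    (hy : ∀ t a, y t a ∈ info u t) (hsde : IsSDESolution A u e y) :
    Constraints S u e ↔ e = revisions H u y := by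
  -- The revision of `x_{t+i}` at time `t` is the discrepancy between the revision of `y_{t+i}` and
  -- `ε^i_t`; it has to be shown that the constraints say that it vanishes for `i < H`.
  set x : ℤ → Fin s → E := fun t b => y t b - ∑ j : Fin H, e j (t - ((j : ℕ) : ℤ)) b with hxdef
  have hx : ∀ t a, x t a ∈ info u t := fun t a => Submodule.sub_mem _ (hy t a)
    (Submodule.sum_mem _ fun j _ => info_mono u (by omega) (he.mem _ _ _))
  have hpix : ∀ t a, lagApply (piPoly A) x t a = zeta A e (t - J1 A) a - u (t - J1 A) a := by
    intro t a
    rw [hxdef, lagApply_sub, hsde t a]; abel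
  have hrev : ∀ t, ∀ i : Fin H, ∀ a, rev u t (x (t + ((i : ℕ) : ℤ)) a) =
      revisions H u y i t a - e i t a := by
    intro t i a
    simp only [hxdef, map_sub, map_sum, he.rev_eq, revisions]
    rw [Finset.sum_eq_single i]
    · simp
    · intro j _ hj
      refine if_neg fun h => hj ?_
      ext; omega
    · simp
  rw [constraints_iff_rev_forcing S he]
  simp only [← fun t : ℤ => lagApply_phi_mul_Q S (ψ := fun t a => zeta A e t a - u t a) hpix t]
  rw [forall_congr' fun t => rev_lagApply_eq_zero_iff S.det_coeff_zero_ne_zero hx t H]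
  constructor
  · intro h
    ext j t a
    have := h t j j.2 a
    rw [hrev, sub_eq_zero] at this
    exact this.symm
  · intro h t i hi a
    have := hrev t ⟨i, hi⟩ a
    rw [← h, sub_self] at this
    exact this

end ConstraintsAsRevisions

/-! ### Moving averages of the innovations -/

section MovingAverages

variable {E : Type*} [NormedAddCommGroup E] [InnerProductSpace ℝ E] {s q K H : ℕ}
  {u : ℤ → Fin s → E} {ε : ℤ → Fin q → E} {W : ℕ → Matrix (Fin s) (Fin q) ℝ}

lemma det_ne_zero_of_rank_eq {Sig : Matrix (Fin q) (Fin q) ℝ} (h : Sig.rank = q) :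
    Sig.det ≠ 0 := by
  have h1 : LinearMap.range Sig.mulVecLin = ⊤ := by
    apply Submodule.eq_top_of_finrank_eq
    rw [Module.finrank_fin_fun]; exact h
  have h2 : Function.Surjective Sig.mulVec := LinearMap.range_eq_top.1 h1
  exact ((Matrix.isUnit_iff_isUnit_det _).1 (Matrix.mulVec_surjective_iff_isUnit.1 h2)).ne_zero

/-- The covariance matrix of the innovations is non-singular. -/
lemma IsWold.exists_cov (hW : IsWold u ε W) : ∃ Sig : Matrix (Fin q) (Fin q) ℝ, Sig.det ≠ 0 ∧
    ∀ t t' a b, inner ℝ (ε t a) (ε t' b) = if t = t' then Sig a b else 0 := by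
  obtain ⟨Sig, h1, h2⟩ := hW.white
  exact ⟨Sig, det_ne_zero_of_rank_eq h1, h2⟩

lemma hasSum_inner_left {ι : Type*} {f : ι → E} {x : E} (h : HasSum f x) (y : E) :
    HasSum (fun i => inner ℝ (f i) y) (inner ℝ x y) := by
  have := h.mapL (innerSL ℝ y)
  simpa [real_inner_comm y] using this

lemma IsWold.inner_eq_zero (hW : IsWold u ε W) {t t' : ℤ} (htt : t < t') {x : E}
    (hx : x ∈ info u t) (b : Fin q) : inner ℝ x (ε t' b) = 0 := by
  obtain ⟨Sig, -, hS⟩ := hW.exists_cov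
  have hle : info u t ≤ (ℝ ∙ ε t' b)ᗮ := by
    refine Submodule.topologicalClosure_minimal _ (Submodule.span_le.2 ?_)
      (Submodule.isClosed_orthogonal _)
    rintro x ⟨j, i, rfl⟩
    refine (Submodule.mem_orthogonal_singleton_iff_inner_left (𝕜 := ℝ)).2 ?_
    refine (hasSum_inner_left (hW.repr (t - j) i) (ε t' b)).unique ?_
    convert hasSum_zero using 2 with l
    rw [sum_inner]
    refine Finset.sum_eq_zero fun c _ => ?_
    rw [real_inner_smul_left, hS, if_neg (by omega), mul_zero]
  exact (Submodule.mem_orthogonal_singleton_iff_inner_left (𝕜 := ℝ)).1 (hle hx)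

/-- The components of `ε_t` are linearly independent. -/
lemma IsWold.coeff_unique (hW : IsWold u ε W) {t : ℤ} {c c' : Fin q → ℝ}
    (h : ∑ b, c b • ε t b = ∑ b, c' b • ε t b) : c = c' := by
  obtain ⟨Sig, hdet, hS⟩ := hW.exists_cov
  refine Matrix.vecMul_injective_of_isUnit
    ((Matrix.isUnit_iff_isUnit_det _).2 hdet.isUnit) (funext fun b' => ?_)
  have := congrArg (fun x => inner ℝ x (ε t b')) h
  simpa [sum_inner, real_inner_smul_left, hS, Matrix.vecMul, dotProduct] using this

lemma IsWold.info_le (hW : IsWold u ε W) (t : ℤ) :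
    info u t ≤ (⨆ j : ℕ, Submodule.span ℝ (Set.range (ε (t - j)))).topologicalClosure := by
  refine Submodule.topologicalClosure_minimal _ (Submodule.span_le.2 ?_)
    (Submodule.isClosed_topologicalClosure _)
  rintro x ⟨j, i, rfl⟩
  refine mem_closure_of_tendsto (hW.repr (t - j) i) (Filter.Eventually.of_forall fun I => ?_)
  refine Submodule.sum_mem _ fun l _ => Submodule.sum_mem _ fun b _ =>
    Submodule.smul_mem _ _ (Submodule.mem_iSup_of_mem (j + l) (Submodule.subset_span ⟨b, ?_⟩))
  push_cast; congr 1; ring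

/-- A scalar process is stationarily correlated with the innovations: its second moments with `ε` are
invariant under simultaneous shifts, forwards or backwards in time. -/
def IsCoStationary (ε : ℤ → Fin q → E) (x : ℤ → E) : Prop :=
  ∀ t t' m b, inner ℝ (x (t + m)) (ε (t' + m) b) = inner ℝ (x t) (ε t' b)

lemma inner_movingAverage {Sig : Matrix (Fin q) (Fin q) ℝ}
    (hS : ∀ t t' a b, inner ℝ (ε t a) (ε t' b) = if t = t' then Sig a b else 0)
    {t : ℤ} {c : ℕ → Fin q → ℝ} {x : E}
    (h : HasSum (fun j : ℕ => ∑ b, c j b • ε (t - j) b) x) (n : ℕ) (b' : Fin q) :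
    inner ℝ x (ε (t - n) b') = Matrix.vecMul (c n) Sig b' := by
  refine (hasSum_inner_left h _).unique ?_
  convert hasSum_single n ?_ using 1
  · simp [sum_inner, real_inner_smul_left, hS, Matrix.vecMul, dotProduct]
  · intro j hj
    rw [sum_inner]
    refine Finset.sum_eq_zero fun b _ => ?_
    rw [real_inner_smul_left, hS, if_neg (by omega), mul_zero]

lemma IsWold.movingAverage_mem (hW : IsWold u ε W) {t : ℤ} {c : ℕ → Fin q → ℝ} {x : E}
    (h : HasSum (fun j : ℕ => ∑ b, c j b • ε (t - j) b) x) : x ∈ info u t :=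
  (isClosed_info u t).mem_of_tendsto h (Filter.Eventually.of_forall fun I =>
    Submodule.sum_mem _ fun l _ => Submodule.sum_mem _ fun b _ =>
    Submodule.smul_mem _ _ (info_mono u (by omega) (hW.innovation _ b)))

lemma IsWold.isCoStationary_of_movingAverage (hW : IsWold u ε W) {c : ℕ → Fin q → ℝ} {x : ℤ → E}
    (h : ∀ t, HasSum (fun j : ℕ => ∑ b, c j b • ε (t - j) b) (x t)) : IsCoStationary ε x := by
  obtain ⟨Sig, -, hS⟩ := hW.exists_cov
  intro t t' m b
  rcases le_or_gt t' t with htt | htt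
  · have h1 : ∀ r : ℤ, inner ℝ (x (t + r)) (ε (t' + r) b) =
        Matrix.vecMul (c (t - t').toNat) Sig b := fun r => by
      rw [← inner_movingAverage hS (h (t + r)) (t - t').toNat b]
      congr 2; omega
    have h2 := h1 0
    simp only [add_zero] at h2
    rw [h1, h2]
  · rw [hW.inner_eq_zero (by omega : t + m < t' + m) (hW.movingAverage_mem (h _)),
      hW.inner_eq_zero htt (hW.movingAverage_mem (h _))]

lemma IsCoStationary.shift {x : ℤ → E} (hx : IsCoStationary ε x) (d : ℤ) :
    IsCoStationary ε fun t => x (t + d) := fun t t' m b => by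
  rw [← hx (t + d) t' m b, add_right_comm]

lemma IsCoStationary.sub {x y : ℤ → E} (hx : IsCoStationary ε x) (hy : IsCoStationary ε y) :
    IsCoStationary ε fun t => x t - y t := fun t t' m b => by
  rw [inner_sub_left, inner_sub_left, hx, hy]

lemma IsCoStationary.add {x y : ℤ → E} (hx : IsCoStationary ε x) (hy : IsCoStationary ε y) :
    IsCoStationary ε fun t => x t + y t := fun t t' m b => by
  rw [inner_add_left, inner_add_left, hx, hy]

lemma IsCoStationary.smul {x : ℤ → E} (hx : IsCoStationary ε x) (c : ℝ) :
    IsCoStationary ε fun t => c • x t := fun t t' m b => by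
  rw [real_inner_smul_left, real_inner_smul_left, hx]

lemma IsCoStationary.zero : IsCoStationary ε fun _ => 0 := fun t t' m b => by simp

lemma IsCoStationary.neg {x : ℤ → E} (hx : IsCoStationary ε x) :
    IsCoStationary ε fun t => -x t := fun t t' m b => by
  rw [inner_neg_left, inner_neg_left, hx]

lemma IsCoStationary.sum {ι : Type*} {I : Finset ι} {x : ι → ℤ → E}
    (hx : ∀ i ∈ I, IsCoStationary ε (x i)) : IsCoStationary ε fun t => ∑ i ∈ I, x i t :=
  fun t t' m b => by
    rw [sum_inner, sum_inner]
    exact Finset.sum_congr rfl fun i hi => hx i hi t t' m b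

lemma IsCoStationary.lagApply {m n : ℕ} {x : ℤ → Fin n → E}
    (hx : ∀ b, IsCoStationary ε fun t => x t b) (M : Matrix (Fin m) (Fin n) ℝ[X]) (a : Fin m) :
    IsCoStationary ε fun t => lagApply M x t a :=
  .sum fun b _ => .sum fun l _ => .smul ((hx b).shift (-l)) _

lemma IsWold.isCoStationary_innovation (hW : IsWold u ε W) (b : Fin q) :
    IsCoStationary ε fun t => ε t b := fun t t' m b' => by
  obtain ⟨Sig, -, hS⟩ := hW.exists_cov
  rw [hS, hS]; simp

lemma IsWold.isCoStationary_mds (hW : IsWold u ε W) (η : Matrix (Fin H × Fin s) (Fin q) ℝ)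
    (j : Fin H) (a : Fin s) : IsCoStationary ε fun t => mds ε η j t a :=
  .sum fun b _ => (hW.isCoStationary_innovation b).smul _

lemma isCoStationary_zeta {e : Fin H → ℤ → Fin s → E}
    (he : ∀ j a, IsCoStationary ε fun t => e j t a) (A : Coeffs ℝ s K H) (a : Fin s) :
    IsCoStationary ε fun t => zeta A e t a := by
  refine .neg (.sum fun k _ => .sum fun j _ => .sum fun h _ => ?_)
  split_ifs
  · exact .sum fun b _ => ((he j b).shift _).smul _
  · exact .zero

variable [CompleteSpace E]

lemma IsWold.exists_hasSum (hW : IsWold u ε W) {t : ℤ} {x : E} (hx : x ∈ info u t) :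
    ∃ c : ℕ → Fin q → ℝ, HasSum (fun j : ℕ => ∑ b, c j b • ε (t - j) b) x := by
  obtain ⟨Sig, -, hS⟩ := hW.exists_cov
  let V : ℕ → Submodule ℝ E := fun j => Submodule.span ℝ (Set.range (ε (t - j)))
  have hV : OrthogonalFamily ℝ (fun j => V j) fun j => (V j).subtypeₗᵢ := by
    refine OrthogonalFamily.of_pairwise fun i j hij => ?_
    change V i ⟂ V j
    rw [Submodule.isOrtho_span]
    rintro _ ⟨a, rfl⟩ _ ⟨b, rfl⟩
    rw [hS, if_neg (by omega)]
  have hx' := hW.info_le t hx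
  have : ∀ j, FiniteDimensional ℝ (V j) := fun j =>
    FiniteDimensional.span_of_finite ℝ (Set.finite_range _)
  have : ∀ j, CompleteSpace (V j) := fun j => FiniteDimensional.complete ℝ _
  have hr := hV.range_linearIsometry
  simp only [Submodule.subtypeₗᵢ_toLinearMap, Submodule.range_subtype] at hr
  rw [← hr] at hx'
  obtain ⟨f, rfl⟩ := hx'
  have hf : ∀ j : ℕ, ∃ c : Fin q → ℝ, ∑ b, c b • ε (t - j) b = (f j : E) := fun j =>
    (Submodule.mem_span_range_iff_exists_fun ℝ).1 (f j).2
  choose c hc using hf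
  refine ⟨c, ?_⟩
  simp only [hc]
  exact hV.hasSum_linearIsometry f

/-- Processes that are adapted and stationarily correlated with the innovations are moving averages
with constant coefficients. -/
theorem IsWold.exists_movingAverage (hW : IsWold u ε W) {x : ℤ → E} (hx : ∀ t, x t ∈ info u t)
    (hst : IsCoStationary ε x) :
    ∃ c : ℕ → Fin q → ℝ, ∀ t, HasSum (fun j : ℕ => ∑ b, c j b • ε (t - j) b) (x t) := by
  obtain ⟨Sig, hdet, hS⟩ := hW.exists_cov
  choose c hc using fun t => hW.exists_hasSum (hx t)
  refine ⟨c 0, fun t => ?_⟩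
  -- The covariances determine the coefficients, as the covariance matrix is non-singular.
  have : c t = c 0 := by
    funext j
    refine Matrix.vecMul_injective_of_isUnit
      ((Matrix.isUnit_iff_isUnit_det _).2 hdet.isUnit) (funext fun b' => ?_)
    beta_reduce
    rw [← inner_movingAverage hS (hc t), ← inner_movingAverage hS (hc 0),
      ← hst 0 (0 - j) t b']
    congr 2 <;> ring
  rw [← this]; exact hc t

theorem IsWold.isCausalStationary_iff (hW : IsWold u ε W) {y : ℤ → Fin s → E} :
    IsCausalStationary ε y ↔
      (∀ t a, y t a ∈ info u t) ∧ ∀ a, IsCoStationary ε fun t => y t a := by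
  constructor
  · rintro ⟨c, hc⟩
    exact ⟨fun t a => hW.movingAverage_mem (c := fun j => c j a) (hc t a),
      fun a => hW.isCoStationary_of_movingAverage (c := fun j => c j a) fun t => hc t a⟩
  · rintro ⟨h1, h2⟩
    choose c hc using fun a => hW.exists_movingAverage (fun t => h1 t a) (h2 a)
    exact ⟨fun j => Matrix.of fun a => c a j, fun t a => hc a t⟩

lemma IsWold.proj_sub_one (hW : IsWold u ε W) (t : ℤ) (b : Fin q) : proj u (t - 1) (ε t b) = 0 :=
  proj_eq_zero_of_orthogonal fun _ hy => hW.inner_eq_zero (by omega) hy b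

lemma IsWold.rev_innovation (hW : IsWold u ε W) (t t' : ℤ) (b : Fin q) :
    rev u t (ε t' b) = if t = t' then ε t' b else 0 :=
  rev_of_innovation (proj_of_mem (hW.innovation t' b)) (hW.proj_sub_one t' b)

lemma IsWold.isMDS (hW : IsWold u ε W) (η : Matrix (Fin H × Fin s) (Fin q) ℝ) :
    IsMDS u (mds ε η) := by
  intro j t a
  simp only [condExp_eq_proj, mds, map_sum, map_smul, proj_of_mem (hW.innovation _ _),
    hW.proj_sub_one, smul_zero, Finset.sum_const_zero, and_self]

/-- The revision of a moving average at lag `n` is its `n`-th term. -/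
lemma IsWold.rev_movingAverage (hW : IsWold u ε W) {t : ℤ} {c : ℕ → Fin q → ℝ} {x : E} (n : ℕ)
    (h : HasSum (fun j : ℕ => ∑ b, c j b • ε (t + n - j) b) x) :
    rev u t x = ∑ b, c n b • ε t b := by
  refine (h.mapL (rev u t)).unique ?_
  convert hasSum_single n ?_ using 1
  · simp [hW.rev_innovation]
  · intro j hj
    rw [map_sum]
    refine Finset.sum_eq_zero fun b _ => ?_
    rw [map_smul, hW.rev_innovation, if_neg (by omega), smul_zero]

/-- An element of `H_u(t)` is determined by its revisions: the innovations leave nothing in the remote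
past. -/
lemma IsWold.eq_zero_of_rev (hW : IsWold u ε W) {t : ℤ} {x : E} (hx : x ∈ info u t)
    (h : ∀ j : ℕ, rev u (t - j) x = 0) : x = 0 := by
  obtain ⟨c, hc⟩ := hW.exists_hasSum hx
  refine hc.unique ?_
  convert hasSum_zero using 2 with j
  rw [← h j, hW.rev_movingAverage (t := t - j) (c := c) j (by simpa using hc)]

/-- The norm of a moving average with constant coefficients does not depend on time. -/
lemma IsWold.norm_eq (hW : IsWold u ε W) {x : ℤ → E} (hx : ∀ t, x t ∈ info u t)
    (hst : IsCoStationary ε x) (t : ℤ) : ‖x t‖ = ‖x 0‖ := by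
  obtain ⟨c, hc⟩ := hW.exists_movingAverage hx hst
  have h1 : ∀ t, HasSum (fun j : ℕ => ∑ b, c j b * inner ℝ (x 0) (ε (0 - j) b))
      (‖x t‖ ^ 2) := by
    intro t
    rw [← real_inner_self_eq_norm_sq]
    convert hasSum_inner_left (hc t) (x t) using 2 with j
    rw [sum_inner]
    refine Finset.sum_congr rfl fun b _ => ?_
    rw [real_inner_smul_left, real_inner_comm (x t), ← hst 0 (0 - j) t b]
    congr 3 <;> ring
  have := (h1 t).unique (h1 0)
  exact (pow_left_inj₀ (norm_nonneg _) (norm_nonneg _) two_ne_zero).1 this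

end MovingAverages

/-! ### Inverses of stable polynomials -/

section StableInverse

/-- The power series `f` has an inverse with absolutely summable coefficients. -/
def HasSummableInverse (f : PowerSeries ℂ) : Prop :=
  ∃ g, f * g = 1 ∧ Summable fun n => ‖PowerSeries.coeff n g‖

lemma HasSummableInverse.mul {f₁ f₂ : PowerSeries ℂ} (h₁ : HasSummableInverse f₁)
    (h₂ : HasSummableInverse f₂) : HasSummableInverse (f₁ * f₂) := by
  obtain ⟨g₁, e₁, s₁⟩ := h₁
  obtain ⟨g₂, e₂, s₂⟩ := h₂
  refine ⟨g₁ * g₂, by rw [mul_mul_mul_comm, e₁, e₂, one_mul], ?_⟩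
  simpa only [PowerSeries.coeff_mul] using
    summable_norm_sum_mul_antidiagonal_of_summable_norm s₁ s₂

lemma hasSummableInverse_C {a : ℂ} (ha : a ≠ 0) : HasSummableInverse (PowerSeries.C a) := by
  refine ⟨PowerSeries.C a⁻¹, by rw [← map_mul, mul_inv_cancel₀ ha, map_one], ?_⟩
  refine summable_of_ne_finset_zero (s := {0}) fun n hn => ?_
  rw [PowerSeries.coeff_C, if_neg (by simpa using hn), norm_zero]

lemma hasSummableInverse_X_sub_C {r : ℂ} (hr : 1 < ‖r‖) :
    HasSummableInverse (PowerSeries.X - PowerSeries.C r) := by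
  have h0 : r ≠ 0 := by rintro rfl; norm_num at hr
  refine ⟨PowerSeries.mk fun n => -(r⁻¹) ^ (n + 1), ?_, ?_⟩
  · ext n
    rcases n with _ | n
    · simp [sub_mul, h0]
    · rw [sub_mul, map_sub, PowerSeries.coeff_succ_X_mul, PowerSeries.coeff_C_mul,
        PowerSeries.coeff_mk, PowerSeries.coeff_mk, PowerSeries.coeff_one, if_neg n.succ_ne_zero,
        pow_succ' _ (n + 1), mul_neg, mul_inv_cancel_left₀ h0, sub_self]
  · simp only [PowerSeries.coeff_mk, norm_neg, norm_pow]
    refine (summable_nat_add_iff 1).2 (summable_geometric_of_lt_one (norm_nonneg _) ?_)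
    rw [norm_inv]; exact inv_lt_one_of_one_lt₀ hr

lemma hasSummableInverse_of_roots {p : ℂ[X]} (hp : ∀ z, p.eval z = 0 → 1 < ‖z‖) :
    HasSummableInverse (p : PowerSeries ℂ) := by
  have hp0 : p ≠ 0 := by
    rintro rfl
    have := hp 0 (by simp)
    norm_num at this
  have hsplit := (IsAlgClosed.splits p).eq_prod_roots
  have key : ∀ R : Multiset ℂ, (∀ r ∈ R, 1 < ‖r‖) →
      HasSummableInverse (((R.map fun r => X - C r).prod : ℂ[X]) : PowerSeries ℂ) := by
    intro R
    induction R using Multiset.induction with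
    | empty =>
      intro _
      have := hasSummableInverse_C one_ne_zero
      simpa using this
    | cons r R ih =>
      intro h
      rw [Multiset.map_cons, Multiset.prod_cons, Polynomial.coe_mul, Polynomial.coe_sub,
        Polynomial.coe_X, Polynomial.coe_C]
      exact (hasSummableInverse_X_sub_C (h r (Multiset.mem_cons_self _ _))).mul
        (ih fun r' hr' => h r' (Multiset.mem_cons_of_mem hr'))
  rw [hsplit, Polynomial.coe_mul, Polynomial.coe_C]
  exact (hasSummableInverse_C (leadingCoeff_ne_zero.2 hp0)).mul
    (key _ fun r hr => hp r ((mem_roots hp0).1 hr))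

/-- A real polynomial without zeros in the closed unit disc has an inverse power series with
absolutely summable coefficients. -/
theorem exists_summable_inverse {p : ℝ[X]} (hp : ∀ z : ℂ, aeval z p = 0 → 1 < ‖z‖) :
    ∃ ψ : PowerSeries ℝ, (p : PowerSeries ℝ) * ψ = 1 ∧
      Summable fun n => ‖PowerSeries.coeff n ψ‖ := by
  obtain ⟨g, hg, hs⟩ := hasSummableInverse_of_roots (p := p.map (algebraMap ℝ ℂ))
    fun z hz => hp z (by rwa [aeval_def, eval₂_eq_eval_map])
  refine ⟨PowerSeries.mk fun n => (PowerSeries.coeff n g).re, ?_, ?_⟩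
  · ext n
    have := congrArg (fun f => (PowerSeries.coeff n f).re) hg
    simp only [PowerSeries.coeff_mul, Polynomial.coeff_coe, coeff_map, Complex.re_sum,
      Complex.coe_algebraMap, Complex.re_ofReal_mul, PowerSeries.coeff_one] at this
    simp only [PowerSeries.coeff_mul, Polynomial.coeff_coe, PowerSeries.coeff_mk, this,
      PowerSeries.coeff_one]
    split_ifs <;> simp
  · refine hs.of_norm_bounded fun n => ?_
    rw [PowerSeries.coeff_mk, norm_norm]
    exact Complex.abs_re_le_norm _

lemma coeff_coe_mul (p : ℝ[X]) (ψ : PowerSeries ℝ) (m : ℕ) :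
    PowerSeries.coeff m ((p : PowerSeries ℝ) * ψ) =
      ∑ l ∈ p.support, p.coeff l * PowerSeries.coeff m (PowerSeries.X ^ l * ψ) := by
  have h : (p : PowerSeries ℝ) =
      ∑ l ∈ p.support, PowerSeries.C (p.coeff l) * PowerSeries.X ^ l := by
    conv_lhs => rw [p.as_sum_support_C_mul_X_pow, ← Polynomial.coeToPowerSeries.ringHom_apply,
      map_sum]
    simp
  conv_lhs => rw [h]
  rw [Finset.sum_mul, map_sum]
  simp [mul_assoc, PowerSeries.coeff_C_mul]

variable {E : Type*} [NormedAddCommGroup E] [InnerProductSpace ℝ E] [CompleteSpace E] {s q : ℕ}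
  {u : ℤ → Fin s → E} {ε : ℤ → Fin q → E} {W : ℕ → Matrix (Fin s) (Fin q) ℝ}

/-- A scalar equation `p(z) w = v` with stable `p` has a causal stationary solution. -/
theorem IsWold.exists_aeval_lag_eq (hW : IsWold u ε W) {p : ℝ[X]}
    (hp : ∀ z : ℂ, aeval z p = 0 → 1 < ‖z‖) {v : ℤ → E} (hv : ∀ t, v t ∈ info u t)
    (hst : IsCoStationary ε v) :
    ∃ w : ℤ → E, (∀ t, w t ∈ info u t) ∧ IsCoStationary ε w ∧ aeval (lag E) p w = v := by
  obtain ⟨ψ, hψ, hs⟩ := exists_summable_inverse hp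
  have hsum : ∀ t, Summable fun n : ℕ => PowerSeries.coeff n ψ • v (t - n) := fun t =>
    (hs.mul_right ‖v 0‖).of_norm_bounded fun n => by
      rw [norm_smul, hW.norm_eq hv hst]
  let w : ℤ → E := fun t => ∑' n : ℕ, PowerSeries.coeff n ψ • v (t - n)
  have hw : ∀ t, HasSum (fun n : ℕ => PowerSeries.coeff n ψ • v (t - n)) (w t) :=
    fun t => (hsum t).hasSum
  refine ⟨w, fun t => ?_, fun t t' m b => ?_, ?_⟩
  · exact (isClosed_info u t).mem_of_tendsto (hw t) (Filter.Eventually.of_forall fun I =>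
      Submodule.sum_mem _ fun n _ => Submodule.smul_mem _ _ (info_mono u (by omega) (hv _)))
  · refine (hasSum_inner_left (hw (t + m)) (ε (t' + m) b)).unique ?_
    convert hasSum_inner_left (hw t) (ε t' b) using 2 with n
    rw [real_inner_smul_left, real_inner_smul_left, ← hst (t - n) t' m b]
    congr 4; ring
  · ext t
    -- Shifting the filtered series by `l` multiplies the power series by `X ^ l`; hence `p(z) w` is
    -- the filter `p ψ = 1` applied to `v`.
    have hwl : ∀ l : ℕ, HasSum
        (fun m : ℕ => PowerSeries.coeff m (PowerSeries.X ^ l * ψ) • v (t - m)) (w (t - l)) := by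
      intro l
      rw [← (add_left_injective l).hasSum_iff]
      · convert hw (t - l) using 2 with n
        simp only [Function.comp_apply, PowerSeries.coeff_X_pow_mul]
        congr 2; push_cast; ring
      · intro m hm
        rw [PowerSeries.coeff_X_pow_mul', if_neg, zero_smul]
        intro hl
        exact hm ⟨m - l, by simp [hl]⟩
    rw [aeval_lag_apply, Polynomial.sum]
    refine (hasSum_sum fun l _ => (hwl l).const_smul (p.coeff l)).unique ?_
    simp only [smul_smul, ← Finset.sum_smul, ← coeff_coe_mul, hψ, PowerSeries.coeff_one]
    convert hasSum_single 0 ?_ using 1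
    · simp
    · intro m hm; simp [hm]

end StableInverse

/-! ### Solutions at a fixed value of the parameters -/

section Fixed

variable {E : Type*} [NormedAddCommGroup E] [InnerProductSpace ℝ E] [CompleteSpace E]
  {s q K H : ℕ} {u : ℤ → Fin s → E} {ε : ℤ → Fin q → E} {W : ℕ → Matrix (Fin s) (Fin q) ℝ}
  {A : Coeffs ℝ s K H}

/-- Solving the model is the same as solving the structural difference equation for some martingale
differences satisfying the constraints; these are then the revisions of the solution. -/
theorem isRESolution_iff_exists_isMDS (S : SmithForm (piPoly A)) {y : ℤ → Fin s → E}
    (hy : ∀ t a, y t a ∈ info u t) :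
    IsRESolution A u y ↔ ∃ e : Fin H → ℤ → Fin s → E, IsMDS u e ∧ Constraints S u e ∧
      IsSDESolution A u e y := by
  rw [isRESolution_iff_revisions A hy]
  constructor
  · intro h
    exact ⟨_, isMDS_revisions u y,
      (constraints_iff_eq_revisions S (isMDS_revisions u y) hy h).2 rfl, h⟩
  · rintro ⟨e, he, hc, hsde⟩
    rw [← (constraints_iff_eq_revisions S he hy hsde).1 hc]
    exact hsde

/-- The revisions of a causal stationary process are constant multiples of the innovations. -/
lemma IsWold.exists_revisions_eq_mds (hW : IsWold u ε W) {y : ℤ → Fin s → E}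
    (hy : IsCausalStationary ε y) :
    ∃ η : Matrix (Fin H × Fin s) (Fin q) ℝ, revisions H u y = mds ε η := by
  obtain ⟨c, hc⟩ := hy
  refine ⟨Matrix.of fun ja => c ja.1 ja.2, ?_⟩
  ext j t a
  exact hW.rev_movingAverage (c := fun j => c j a) j (hc (t + ((j : ℕ) : ℤ)) a)

theorem IsWold.isRESolution_iff_exists_freeParams (hW : IsWold u ε W) (S : SmithForm (piPoly A))
    {y : ℤ → Fin s → E} (hy : IsCausalStationary ε y) :
    IsRESolution A u y ↔ ∃ η ∈ freeParams S u ε, IsSDESolution A u (mds ε η) y := by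
  have hmem := (hW.isCausalStationary_iff.1 hy).1
  constructor
  · intro h
    obtain ⟨η, hη⟩ := hW.exists_revisions_eq_mds (H := H) hy
    rw [isRESolution_iff_revisions A hmem, hη] at h
    exact ⟨η, (constraints_iff_eq_revisions S (hW.isMDS η) hmem h).2 hη.symm, h⟩
  · rintro ⟨η, hη, h⟩
    exact (isRESolution_iff_exists_isMDS S hmem).2 ⟨_, hW.isMDS η, hη, h⟩

/-- In terms of coefficients, the constraints are a system of linear equations with matrix `C`. -/
lemma IsWold.mem_freeParams_iff (hW : IsWold u ε W) (S : SmithForm (piPoly A))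
    {η : Matrix (Fin H × Fin s) (Fin q) ℝ} :
    η ∈ freeParams S u ε ↔ Cmat S * η =
      Dmat S * Matrix.of fun (nb : Fin (numLeads S) × Fin s) b => W nb.1 nb.2 b := by
  have hu : ∀ (t : ℤ) (n : ℕ) (a : Fin s),
      rev u t (u (t + n) a) = ∑ b, W n a b • ε t b := fun t n a =>
    hW.rev_movingAverage (c := fun j => W j a) n (hW.repr (t + n) a)
  have hL : ∀ t ik, ∑ jb : Fin H × Fin s, Cmat S ik jb • mds ε η jb.1 t jb.2 =
      ∑ b, (Cmat S * η) ik b • ε t b := fun t ik => by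
    simp only [mds, Finset.smul_sum, smul_smul, Matrix.mul_apply, Finset.sum_smul]
    exact Finset.sum_comm
  have hR : ∀ t ik, ∑ nb : Fin (numLeads S) × Fin s, Dmat S ik nb •
      (condExp u t (u (t + ((nb.1 : ℕ) : ℤ)) nb.2)
        - condExp u (t - 1) (u (t + ((nb.1 : ℕ) : ℤ)) nb.2)) =
      ∑ b, (Dmat S * Matrix.of fun (nb : Fin (numLeads S) × Fin s) b => W nb.1 nb.2 b) ik b •
        ε t b := fun t ik => by
    simp only [condExp_eq_proj, ← rev_apply, hu, Finset.smul_sum, smul_smul, Matrix.mul_apply,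
      Finset.sum_smul, Matrix.of_apply]
    exact Finset.sum_comm
  simp only [freeParams, Set.mem_ofPred_eq, Constraints, hL, hR]
  constructor
  · intro h
    ext ik b
    exact congrFun (hW.coeff_unique (h 0 ik)) b
  · intro h t ik
    rw [h]

lemma finrank_ker_mul_left {m : Type*} [Fintype m] [DecidableEq m] (C : Matrix m m ℝ) (q : ℕ) :
    Module.finrank ℝ (LinearMap.ker (mulLeftLinearMap (Fin q) ℝ C)) =
      (Fintype.card m - C.rank) * q := by
  have hker : ∀ η : Matrix m (Fin q) ℝ, η ∈ LinearMap.ker (mulLeftLinearMap (Fin q) ℝ C) ↔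
      ∀ b, (fun i => η i b) ∈ LinearMap.ker C.mulVecLin := fun η => by
    simp only [LinearMap.mem_ker, ← Matrix.ext_iff, funext_iff]
    exact forall_comm
  let L : LinearMap.ker (mulLeftLinearMap (Fin q) ℝ C) ≃ₗ[ℝ]
      (Fin q → LinearMap.ker C.mulVecLin) :=
    { toFun := fun η b => ⟨fun i => η.1 i b, (hker η.1).1 η.2 b⟩
      invFun := fun f => ⟨fun i b => (f b).1 i, (hker _).2 fun b => (f b).2⟩
      map_add' := fun _ _ => rfl
      map_smul' := fun _ _ => rfl
      left_inv := fun _ => rfl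
      right_inv := fun _ => rfl }
  have h1 := C.mulVecLin.finrank_range_add_finrank_ker
  rw [Module.finrank_fintype_fun_eq_card] at h1
  rw [L.finrank_eq, Module.finrank_pi_fintype, Finset.sum_const, Finset.card_univ,
    Fintype.card_fin, smul_eq_mul, mul_comm, Matrix.rank, ← h1, Nat.add_sub_cancel_left]

/-- The free parameters form an affine space of dimension `(Hs - rank C) q`. -/
theorem IsWold.exists_affineSubspace_eq_freeParams (hW : IsWold u ε W) (S : SmithForm (piPoly A))
    (hne : (freeParams S u ε).Nonempty) :
    ∃ V : AffineSubspace ℝ (Matrix (Fin H × Fin s) (Fin q) ℝ),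
      (V : Set (Matrix (Fin H × Fin s) (Fin q) ℝ)) = freeParams S u ε ∧
      Module.finrank ℝ V.direction = (H * s - (Cmat S).rank) * q := by
  obtain ⟨η₀, h₀⟩ := hne
  refine ⟨AffineSubspace.mk' η₀ (LinearMap.ker (mulLeftLinearMap (Fin q) ℝ (Cmat S))), ?_, ?_⟩
  · ext η
    rw [SetLike.mem_coe, AffineSubspace.mem_mk', hW.mem_freeParams_iff,
      ← (hW.mem_freeParams_iff S).1 h₀, LinearMap.mem_ker, vsub_eq_sub, map_sub, sub_eq_zero]
    rfl
  · rw [AffineSubspace.direction_mk', finrank_ker_mul_left]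
    simp

/-- The constraints allow the parameters to be read off from the solution, as the coefficients of its
revisions. -/
theorem IsWold.ne_of_freeParams_ne (hW : IsWold u ε W) (S : SmithForm (piPoly A))
    {η η' : Matrix (Fin H × Fin s) (Fin q) ℝ} (hη : η ∈ freeParams S u ε)
    (hη' : η' ∈ freeParams S u ε) (hne : η ≠ η') {y y' : ℤ → Fin s → E}
    (hy : IsCausalStationary ε y) (hsde : IsSDESolution A u (mds ε η) y)
    (hsde' : IsSDESolution A u (mds ε η') y') : y ≠ y' := by
  rintro rfl
  have hmem := (hW.isCausalStationary_iff.1 hy).1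
  have h1 := (constraints_iff_eq_revisions S (hW.isMDS η) hmem hsde).1 hη
  have h2 := (constraints_iff_eq_revisions S (hW.isMDS η') hmem hsde').1 hη'
  refine hne (funext fun ja => hW.coeff_unique (t := 0) ?_)
  exact congrFun (congrFun (congrFun (h1.trans h2.symm) ja.1) 0) ja.2

/-- A causal stationary solution determines the forcing term as a function of the present and
past. -/
lemma IsWold.causalForcing_of_solution (hW : IsWold u ε W) (S : SmithForm (piPoly A))
    {η : Matrix (Fin H × Fin s) (Fin q) ℝ} {y : ℤ → Fin s → E} (hy : ∀ t a, y t a ∈ info u t)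
    (hsde : IsSDESolution A u (mds ε η) y) : CausalForcing S u (mds ε η) := by
  intro t k
  have h : ∀ t a, lagApply (piPoly A)
      (fun t b => y t b - ∑ j : Fin H, mds ε η j (t - ((j : ℕ) : ℤ)) b) t a =
      zeta A (mds ε η) (t - J1 A) a - u (t - J1 A) a := fun t a => by
    rw [lagApply_sub, hsde t a]; abel
  rw [← lagApply_phi_mul_Q S (ψ := fun t a => zeta A (mds ε η) t a - u t a) h]
  exact lagApply_mem _ (fun t' ht' b => info_mono u ht' (Submodule.sub_mem _ (hy t' b)
    (Submodule.sum_mem _ fun j _ => info_mono u (by omega) ((hW.isMDS η).mem _ _ _)))) k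

/-- The difference `d` of two adapted solutions satisfies `Φ(z) Q(z) d = 0`, so it is never revised.
No assumption on the zeros of `det π` is needed. -/
lemma IsWold.solution_unique (hW : IsWold u ε W) (S : SmithForm (piPoly A))
    {e : Fin H → ℤ → Fin s → E} {y y' : ℤ → Fin s → E}
    (hy : ∀ t a, y t a ∈ info u t) (hy' : ∀ t a, y' t a ∈ info u t)
    (hsde : IsSDESolution A u e y) (hsde' : IsSDESolution A u e y') : y = y' := by
  set d : ℤ → Fin s → E := fun t b => y t b - y' t b with hd
  have hmem : ∀ t a, d t a ∈ info u t := fun t a => Submodule.sub_mem _ (hy t a) (hy' t a)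
  have h : ∀ t a, lagApply (piPoly A) d t a = (fun _ _ => (0 : E)) (t - J1 A) a := fun t a => by
    rw [hd, lagApply_sub, hsde t a, hsde' t a, sub_self]
  have h0 : ∀ t k, lagApply (Matrix.diagonal S.φ * S.Q) d t k = 0 := fun t k => by
    rw [lagApply_phi_mul_Q S (ψ := fun _ _ => 0) h]
    simp [RE.lagApply, Polynomial.sum]
  have hrev : ∀ t (j : ℕ) a, rev u t (d (t + j) a) = 0 := fun t j =>
    (rev_lagApply_eq_zero_iff S.det_coeff_zero_ne_zero hmem t (j + 1)).1
      (fun i _ a => by rw [h0, map_zero]) j (by omega)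
  ext t a
  refine sub_eq_zero.1 (hW.eq_zero_of_rev (hmem t a) fun j => ?_)
  have := hrev (t - j) j a
  rwa [sub_add_cancel] at this

lemma SmithForm.one_lt_norm_of_root (S : SmithForm (piPoly A)) (hz : NonzeroZerosOutside A)
    (k : Fin s) {z : ℂ} (h : aeval z (S.φ k) = 0) : 1 < ‖z‖ := by
  refine hz z ?_ ?_
  · rintro rfl
    rw [← coeff_zero_eq_aeval_zero'] at h
    exact S.φ_zero k (by simpa using h)
  · have := congrArg Matrix.det S.eq
    rw [this, Matrix.det_mul, Matrix.det_mul, Matrix.det_diagonal, map_mul, map_mul, map_prod,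
      Finset.prod_eq_zero (Finset.mem_univ k) h, mul_zero, zero_mul]

/-- If the forcing term does not look into the future, `x = Q(z)⁻¹ Φ(z)⁻¹ α(z)⁻¹ P(z)⁻¹(ζ - u)` is
well defined and yields a solution. -/
lemma IsWold.exists_solution (hW : IsWold u ε W) (S : SmithForm (piPoly A))
    (hz : NonzeroZerosOutside A) {η : Matrix (Fin H × Fin s) (Fin q) ℝ}
    (hf : CausalForcing S u (mds ε η)) :
    ∃ y : ℤ → Fin s → E, IsCausalStationary ε y ∧ IsSDESolution A u (mds ε η) y := by
  set ψ : ℤ → Fin s → E := fun t a => zeta A (mds ε η) t a - u t a with hψ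
  have hψst : ∀ a, IsCoStationary ε fun t => ψ t a := fun a =>
    (isCoStationary_zeta (hW.isCoStationary_mds η) A a).sub
      (hW.isCoStationary_of_movingAverage (c := fun j => W j a) fun t => hW.repr t a)
  let v : ℤ → Fin s → E := fun t k => lagApply S.P⁻¹ ψ (t + ((S.g k : ℕ) : ℤ) - J1 A) k
  have hv : ∀ k, IsCoStationary ε fun t => v t k := fun k => by
    have := (IsCoStationary.lagApply hψst S.P⁻¹ k).shift (((S.g k : ℕ) : ℤ) - J1 A)
    simpa only [v, add_sub_assoc] using this
  choose w hwmem hwst hwv using fun k =>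
    hW.exists_aeval_lag_eq (fun z => S.one_lt_norm_of_root hz k) (fun t => hf t k) (hv k)
  let x : ℤ → Fin s → E := lagApply S.Q⁻¹ fun t k => w k t
  let Y : ℤ → Fin s → E := fun t b => ∑ j : Fin H, mds ε η j (t - ((j : ℕ) : ℤ)) b
  have hx : lagApply (piPoly A) x = fun t a => ψ (t - J1 A) a := by
    have h1 : lagApply (Matrix.diagonal S.φ) (fun t k => w k t) = v := by
      ext t k
      rw [lagApply_diagonal, hwv]
    have h2 : piPoly A * S.Q⁻¹ = S.P *
        ((Matrix.diagonal fun i => (X : ℝ[X]) ^ S.g i) * Matrix.diagonal S.φ) := by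
      have := congrArg (· * S.Q⁻¹) S.eq
      simpa only [Matrix.mul_nonsing_inv_cancel_right _ _ S.isUnit_det_Q, Matrix.mul_assoc]
        using this
    have h3 : (lagApply (Matrix.diagonal fun i => (X : ℝ[X]) ^ S.g i) v) =
        lagApply S.P⁻¹ fun t => ψ (t + -J1 A) := by
      ext t k
      rw [lagApply_diagonal_X_pow, lagApply_shift]
      simp only [v]
      congr 1; ring
    rw [← lagApply_mul, h2, lagApply_mul, lagApply_mul, h1, h3, ← lagApply_mul,
      Matrix.mul_nonsing_inv _ S.isUnit_det_P, lagApply_one]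
    rfl
  refine ⟨fun t b => x t b + Y t b, hW.isCausalStationary_iff.2 ⟨fun t a => ?_, fun a => ?_⟩,
    fun t a => ?_⟩
  · exact Submodule.add_mem _
      (lagApply_mem _ (fun t' ht' b => info_mono u ht' (hwmem b t')) a)
      (Submodule.sum_mem _ fun j _ => info_mono u (by omega) ((hW.isMDS η).mem _ _ _))
  · exact (IsCoStationary.lagApply (x := fun t k => w k t) hwst S.Q⁻¹ a).add
      (.sum fun j _ => (hW.isCoStationary_mds η j a).shift (-((j : ℕ) : ℤ)))
  · have h1 := lagApply_sub (piPoly A) (fun t b => x t b + Y t b) Y t a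
    simp only [add_sub_cancel_right] at h1
    have h2 := congrFun (congrFun hx t) a
    rw [h2] at h1
    rw [add_sub_assoc]
    exact (sub_eq_iff_eq_add.1 h1.symm).trans (add_comm _ _)

theorem IsWold.existsUnique_solution_iff (hW : IsWold u ε W) (S : SmithForm (piPoly A))
    (hz : NonzeroZerosOutside A) (η : Matrix (Fin H × Fin s) (Fin q) ℝ) :
    (∃! y : ℤ → Fin s → E, IsCausalStationary ε y ∧ IsSDESolution A u (mds ε η) y) ↔
      CausalForcing S u (mds ε η) := by
  constructor
  · rintro ⟨y, ⟨hy, hsde⟩, -⟩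
    exact hW.causalForcing_of_solution S (hW.isCausalStationary_iff.1 hy).1 hsde
  · intro hf
    obtain ⟨y, hy, hsde⟩ := hW.exists_solution S hz hf
    exact ⟨y, ⟨hy, hsde⟩, fun y' h' => hW.solution_unique S (hW.isCausalStationary_iff.1 h'.1).1
      (hW.isCausalStationary_iff.1 hy).1 h'.2 hsde⟩

theorem causalForcing_of_le (S : SmithForm (piPoly A)) {e : Fin H → ℤ → Fin s → E}
    (he : IsMDS u e) (hg : ∀ k, ((S.g k : ℕ) : ℤ) ≤ J1 A) : CausalForcing S u e := by
  intro t k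
  have := hg k
  exact lagApply_mem _ (fun t' ht' b => Submodule.sub_mem _
    (info_mono u (by omega) (zeta_mem he A t' b)) (info_mono u (by omega) (self_mem_info u t' b))) k

end Fixed

/-! ### Generic values of the parameters -/

section Generic

variable {p s K H : ℕ}

/-- The filter of generic properties: those that hold wherever some non-zero polynomial does not
vanish. -/
def generic (p : ℕ) : Filter (Fin p → ℝ) where
  sets := {T | ∃ F : MvPolynomial (Fin p) ℝ, F ≠ 0 ∧ ∀ θ, MvPolynomial.eval θ F ≠ 0 → θ ∈ T}
  univ_sets := ⟨1, one_ne_zero, fun _ _ => trivial⟩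
  sets_of_superset := fun ⟨F, hF, h⟩ hT => ⟨F, hF, fun θ hθ => hT (h θ hθ)⟩
  inter_sets := fun ⟨F, hF, h⟩ ⟨G, hG, h'⟩ => ⟨F * G, mul_ne_zero hF hG, fun θ hθ => by
    rw [map_mul] at hθ
    exact ⟨h θ (left_ne_zero_of_mul hθ), h' θ (right_ne_zero_of_mul hθ)⟩⟩

lemma eventually_generic_iff {Pr : (Fin p → ℝ) → Prop} : (∀ᶠ θ in generic p, Pr θ) ↔
    ∃ F : MvPolynomial (Fin p) ℝ, F ≠ 0 ∧ ∀ θ, MvPolynomial.eval θ F ≠ 0 → Pr θ := Iff.rfl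

lemma eventually_eval_ne_zero {F : MvPolynomial (Fin p) ℝ} (hF : F ≠ 0) :
    ∀ᶠ θ in generic p, MvPolynomial.eval θ F ≠ 0 := ⟨F, hF, fun _ h => h⟩

/-- A rational function may be evaluated in any representation whose denominator does not vanish at
`θ`, not only in lowest terms. -/
lemma ratEval_eq_div {θ : Fin p → ℝ} {x : RatField p} {a b : MvPolynomial (Fin p) ℝ}
    (hb : MvPolynomial.eval θ b ≠ 0)
    (hx : x * algebraMap _ (RatField p) b = algebraMap _ (RatField p) a) :
    ratEval θ x = MvPolynomial.eval θ a / MvPolynomial.eval θ b := by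
  set n := IsFractionRing.num (MvPolynomial (Fin p) ℝ) x with hn
  set d : MvPolynomial (Fin p) ℝ :=
    (IsFractionRing.den (MvPolynomial (Fin p) ℝ) x : MvPolynomial (Fin p) ℝ) with hd
  have hd0 : algebraMap _ (RatField p) d ≠ 0 :=
    IsFractionRing.to_map_ne_zero_of_mem_nonZeroDivisors
      (IsFractionRing.den (MvPolynomial (Fin p) ℝ) x).2
  have hxd : algebraMap _ (RatField p) n = x * algebraMap _ (RatField p) d := by
    rw [← div_eq_iff hd0]
    exact IsFractionRing.mk'_num_den' _ x
  have hmul : n * b = a * d := by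
    apply IsFractionRing.injective (MvPolynomial (Fin p) ℝ) (RatField p)
    rw [map_mul, map_mul, hxd, ← hx]; ring
  have hrel : IsRelPrime n d := IsFractionRing.num_den_reduced _ x
  have hdvd : d ∣ b := hrel.symm.dvd_of_dvd_mul_left ⟨a, by rw [hmul, mul_comm]⟩
  have hdθ : MvPolynomial.eval θ d ≠ 0 := by
    obtain ⟨c, hc⟩ := hdvd
    rw [hc, map_mul] at hb
    exact left_ne_zero_of_mul hb
  rw [ratEval, ← hn, ← hd, div_eq_div_iff hdθ hb, ← map_mul, ← map_mul, hmul]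

/-- The ring of rational functions that are defined at `θ`. -/
def regularAt (θ : Fin p → ℝ) : Subring (RatField p) where
  carrier := {x | ∃ a b : MvPolynomial (Fin p) ℝ, MvPolynomial.eval θ b ≠ 0 ∧
    x * algebraMap _ (RatField p) b = algebraMap _ (RatField p) a}
  zero_mem' := ⟨0, 1, by simp, by simp⟩
  one_mem' := ⟨1, 1, by simp, by simp⟩
  add_mem' := by
    rintro x y ⟨a, b, hb, hx⟩ ⟨a', b', hb', hy⟩
    refine ⟨a * b' + a' * b, b * b', by simp [hb, hb'], ?_⟩
    simp only [map_add, map_mul, ← hx, ← hy]; ring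
  mul_mem' := by
    rintro x y ⟨a, b, hb, hx⟩ ⟨a', b', hb', hy⟩
    refine ⟨a * a', b * b', by simp [hb, hb'], ?_⟩
    simp only [map_mul, ← hx, ← hy]; ring
  neg_mem' := by
    rintro x ⟨a, b, hb, hx⟩
    exact ⟨-a, b, hb, by rw [map_neg, ← hx, neg_mul]⟩

/-- Evaluation at `θ` is a ring homomorphism on the rational functions that are defined there. -/
noncomputable def ratEvalHom (θ : Fin p → ℝ) : regularAt θ →+* ℝ where
  toFun x := ratEval θ x
  map_zero' := by
    rw [ratEval_eq_div (a := 0) (b := 1) (by simp) (by simp)]; simp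
  map_one' := by
    rw [ratEval_eq_div (a := 1) (b := 1) (by simp) (by simp)]; simp
  map_add' := by
    rintro ⟨x, a, b, hb, hx⟩ ⟨y, a', b', hb', hy⟩
    rw [Subring.coe_add, ratEval_eq_div hb hx, ratEval_eq_div hb' hy,
      ratEval_eq_div (a := a * b' + b * a') (b := b * b') (by simp [hb, hb']), div_add_div _ _ hb hb']
    · simp
    · simp only [map_add, map_mul, ← hx, ← hy]; ring
  map_mul' := by
    rintro ⟨x, a, b, hb, hx⟩ ⟨y, a', b', hb', hy⟩
    rw [Subring.coe_mul, ratEval_eq_div hb hx, ratEval_eq_div hb' hy,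
      ratEval_eq_div (a := a * a') (b := b * b') (by simp [hb, hb']), div_mul_div_comm]
    · simp
    · simp only [map_mul, ← hx, ← hy]; ring

lemma ratEval_zero (θ : Fin p → ℝ) : ratEval θ 0 = 0 := (ratEvalHom θ).map_zero

lemma ratEval_one (θ : Fin p → ℝ) : ratEval θ 1 = 1 := (ratEvalHom θ).map_one

lemma ratEval_neg {θ : Fin p → ℝ} {x : RatField p} (hx : x ∈ regularAt θ) :
    ratEval θ (-x) = -ratEval θ x := (ratEvalHom θ).map_neg ⟨x, hx⟩

lemma ratEval_add {θ : Fin p → ℝ} {x y : RatField p} (hx : x ∈ regularAt θ)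
    (hy : y ∈ regularAt θ) : ratEval θ (x + y) = ratEval θ x + ratEval θ y :=
  (ratEvalHom θ).map_add ⟨x, hx⟩ ⟨y, hy⟩

lemma ratEval_mul {θ : Fin p → ℝ} {x y : RatField p} (hx : x ∈ regularAt θ)
    (hy : y ∈ regularAt θ) : ratEval θ (x * y) = ratEval θ x * ratEval θ y :=
  (ratEvalHom θ).map_mul ⟨x, hx⟩ ⟨y, hy⟩

lemma ratEval_sum {ι : Type*} {θ : Fin p → ℝ} {I : Finset ι} {x : ι → RatField p}
    (hx : ∀ i, x i ∈ regularAt θ) : ratEval θ (∑ i ∈ I, x i) = ∑ i ∈ I, ratEval θ (x i) := by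
  have h : ((∑ i ∈ I, (⟨x i, hx i⟩ : regularAt θ) : regularAt θ) : RatField p) = ∑ i ∈ I, x i := by
    simp
  rw [← h]
  exact map_sum (ratEvalHom θ) (fun i => (⟨x i, hx i⟩ : regularAt θ)) I

lemma coeff_polyAt (θ : Fin p → ℝ) (f : (RatField p)[X]) (n : ℕ) :
    (polyAt θ f).coeff n = ratEval θ (f.coeff n) := by
  rw [polyAt, finsetSum_coeff]
  simp only [coeff_monomial, Finset.sum_ite_eq']
  split_ifs with h
  · rfl
  · rw [notMem_support_iff.1 h, ratEval_zero]

/-- The polynomials in `z` whose coefficients are defined at `θ`. -/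
def polyRegularAt (θ : Fin p → ℝ) : Subring (RatField p)[X] where
  carrier := {f | ∀ n, f.coeff n ∈ regularAt θ}
  zero_mem' := fun n => by rw [coeff_zero]; exact Subring.zero_mem _
  one_mem' := fun n => by
    rw [coeff_one]; split_ifs
    exacts [Subring.one_mem _, Subring.zero_mem _]
  add_mem' := fun hf hg n => by rw [coeff_add]; exact Subring.add_mem _ (hf n) (hg n)
  mul_mem' := fun hf hg n => by
    rw [coeff_mul]; exact Subring.sum_mem _ fun i _ => Subring.mul_mem _ (hf _) (hg _)
  neg_mem' := fun hf n => by rw [coeff_neg]; exact Subring.neg_mem _ (hf n)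

/-- Evaluation at `θ` as a ring homomorphism on polynomials whose coefficients are defined there. -/
noncomputable def polyAtHom (θ : Fin p → ℝ) : polyRegularAt θ →+* ℝ[X] where
  toFun f := polyAt θ f
  map_zero' := by ext n; simp [coeff_polyAt, ratEval_zero]
  map_one' := by
    ext n
    rw [coeff_polyAt, Subring.coe_one, coeff_one, coeff_one]
    split_ifs
    exacts [ratEval_one θ, ratEval_zero θ]
  map_add' f g := by
    ext n
    rw [coeff_add, coeff_polyAt, coeff_polyAt, coeff_polyAt, Subring.coe_add, coeff_add,
      ratEval_add (f.2 n) (g.2 n)]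
  map_mul' f g := by
    ext n
    rw [coeff_polyAt, Subring.coe_mul, coeff_mul, coeff_mul, ratEval_sum]
    · refine Finset.sum_congr rfl fun i _ => ?_
      rw [ratEval_mul (f.2 _) (g.2 _), coeff_polyAt, coeff_polyAt]
    · exact fun i => Subring.mul_mem _ (f.2 _) (g.2 _)

section SubringMap

/-! ### Entrywise maps that are multiplicative on a subring -/

variable {R R' n : Type*} [CommRing R] [CommRing R'] [Fintype n] {T : Subring R}
  {f : R → R'} {M N : Matrix n n R}

lemma map_mul_of_mem (φ : T →+* R') (hφ : ∀ x : T, f x = φ x) (hM : ∀ i j, M i j ∈ T)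
    (hN : ∀ i j, N i j ∈ T) : (M * N).map f = M.map f * N.map f := by
  ext i j
  have h1 : (M * N) i j = ((∑ k, (⟨M i k, hM i k⟩ : T) * ⟨N k j, hN k j⟩ : T) : R) := by
    simp [Matrix.mul_apply]
  rw [Matrix.map_apply, h1, hφ, map_sum, Matrix.mul_apply]
  refine Finset.sum_congr rfl fun k _ => ?_
  rw [map_mul, ← hφ, ← hφ]; rfl

lemma map_det_of_mem [DecidableEq n] (φ : T →+* R') (hφ : ∀ x : T, f x = φ x)
    (hM : ∀ i j, M i j ∈ T) :
    f M.det = (M.map f).det := by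
  let M' : Matrix n n T := Matrix.of fun i j => ⟨M i j, hM i j⟩
  have h1 : M.det = ((M'.det : T) : R) := (T.subtype.map_det M').symm
  have h2 : M.map f = φ.mapMatrix M' := by
    ext i j; exact hφ ⟨M i j, hM i j⟩
  rw [h1, hφ, φ.map_det, h2]

end SubringMap

lemma eventually_mem_regularAt (x : RatField p) : ∀ᶠ θ in generic p, x ∈ regularAt θ := by
  obtain ⟨a, b, hb, rfl⟩ := IsFractionRing.div_surjective (A := MvPolynomial (Fin p) ℝ) x
  refine (eventually_eval_ne_zero (nonZeroDivisors.ne_zero hb)).mono fun θ hθ => ⟨a, b, hθ, ?_⟩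
  exact div_mul_cancel₀ _ (IsFractionRing.to_map_ne_zero_of_mem_nonZeroDivisors hb)

lemma eventually_ratEval_ne_zero {x : RatField p} (hx : x ≠ 0) :
    ∀ᶠ θ in generic p, ratEval θ x ≠ 0 := by
  filter_upwards [eventually_mem_regularAt x, eventually_mem_regularAt x⁻¹] with θ h h' h0
  have := ratEval_mul h h'
  rw [mul_inv_cancel₀ hx, ratEval_one, h0, zero_mul] at this
  exact one_ne_zero this

lemma eventually_mem_polyRegularAt (f : (RatField p)[X]) :
    ∀ᶠ θ in generic p, f ∈ polyRegularAt θ := by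
  have : ∀ᶠ θ in generic p, ∀ n ∈ f.support, f.coeff n ∈ regularAt θ :=
    (Filter.eventually_all_finset _).2 fun n _ => eventually_mem_regularAt _
  filter_upwards [this] with θ h n
  by_cases hn : n ∈ f.support
  · exact h n hn
  · rw [notMem_support_iff.1 hn]; exact Subring.zero_mem _

lemma eventually_matrix_mem_polyRegularAt {m n : Type*} [Finite m] [Finite n]
    (M : Matrix m n (RatField p)[X]) : ∀ᶠ θ in generic p, ∀ i j, M i j ∈ polyRegularAt θ :=
  Filter.eventually_all.2 fun _ => Filter.eventually_all.2 fun _ => eventually_mem_polyRegularAt _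

lemma eventually_matrix_mem_regularAt {m n : Type*} [Finite m] [Finite n]
    (M : Matrix m n (RatField p)) : ∀ᶠ θ in generic p, ∀ i j, M i j ∈ regularAt θ :=
  Filter.eventually_all.2 fun _ => Filter.eventually_all.2 fun _ => eventually_mem_regularAt _

lemma polyAt_zero (θ : Fin p → ℝ) : polyAt θ 0 = 0 := (polyAtHom θ).map_zero

lemma polyAt_one (θ : Fin p → ℝ) : polyAt θ 1 = 1 := (polyAtHom θ).map_one

lemma polyAt_X_pow (θ : Fin p → ℝ) (n : ℕ) : polyAt θ (X ^ n) = X ^ n := by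
  ext m
  rw [coeff_polyAt, coeff_X_pow, coeff_X_pow]
  split_ifs
  exacts [ratEval_one θ, ratEval_zero θ]

lemma eventually_polyAt_ne_zero {f : (RatField p)[X]} (hf : f ≠ 0) :
    ∀ᶠ θ in generic p, polyAt θ f ≠ 0 := by
  have hn : f.coeff f.natDegree ≠ 0 := leadingCoeff_ne_zero.2 hf
  filter_upwards [eventually_ratEval_ne_zero hn] with θ h h0
  rw [← coeff_polyAt, h0, coeff_zero] at h
  exact h rfl

lemma eventually_polyAt_dvd {f g : (RatField p)[X]} (h : f ∣ g) :
    ∀ᶠ θ in generic p, polyAt θ f ∣ polyAt θ g := by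
  obtain ⟨c, rfl⟩ := h
  filter_upwards [eventually_mem_polyRegularAt f, eventually_mem_polyRegularAt c] with θ hf hc
  exact ⟨polyAt θ c, (polyAtHom θ).map_mul ⟨f, hf⟩ ⟨c, hc⟩⟩

lemma eventually_map_polyAt_mul (M N : Matrix (Fin s) (Fin s) (RatField p)[X]) :
    ∀ᶠ θ in generic p, (M * N).map (polyAt θ) = M.map (polyAt θ) * N.map (polyAt θ) := by
  filter_upwards [eventually_matrix_mem_polyRegularAt M, eventually_matrix_mem_polyRegularAt N]
    with θ hM hN
  exact map_mul_of_mem (polyAtHom θ) (fun _ => rfl) hM hN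

lemma eventually_polyAt_det (M : Matrix (Fin s) (Fin s) (RatField p)[X]) :
    ∀ᶠ θ in generic p, polyAt θ M.det = (M.map (polyAt θ)).det := by
  filter_upwards [eventually_matrix_mem_polyRegularAt M] with θ hM
  exact map_det_of_mem (polyAtHom θ) (fun _ => rfl) hM

/-- Unimodular polynomial matrices stay unimodular at generic parameter values. -/
lemma eventually_unimodular {M : Matrix (Fin s) (Fin s) (RatField p)[X]} (hM : IsUnit M.det) :
    ∀ᶠ θ in generic p, IsUnit (M.map (polyAt θ)).det ∧
      (M.map (polyAt θ))⁻¹ = M⁻¹.map (polyAt θ) := by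
  filter_upwards [eventually_map_polyAt_mul M M⁻¹] with θ h
  rw [Matrix.mul_nonsing_inv _ hM, Matrix.map_one _ (polyAt_zero θ) (polyAt_one θ)] at h
  refine ⟨IsUnit.of_mul_eq_one _ (by rw [← Matrix.det_mul, ← h, Matrix.det_one]),
    Matrix.inv_eq_right_inv h.symm⟩

lemma rank_fromBlocks_one_zero {m r k : Type*} [Fintype m] [Fintype r] [Fintype k]
    [DecidableEq r] [DecidableEq k] (e : m ≃ r ⊕ k) :
    ((Matrix.fromBlocks (1 : Matrix r r ℝ) 0 0 (0 : Matrix k k ℝ)).submatrix e e).rank =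
      Fintype.card r := by
  classical
  rw [Matrix.rank_submatrix, ← Matrix.diagonal_one, ← Matrix.diagonal_zero,
    Matrix.fromBlocks_diagonal, Matrix.rank_diagonal]
  rw [Fintype.card_subtype, Finset.card_filter, Fintype.sum_sum_type]
  simp

/-- The rank of a matrix of rational functions does not change at generic parameter values. -/
lemma eventually_rank_map_ratEval {m : Type*} [Fintype m] [DecidableEq m]
    (M : Matrix m m (RatField p)) :
    ∀ᶠ θ in generic p, (M.map (ratEval θ)).rank = M.rank := by
  obtain ⟨V, U, e, hV, hU, hE⟩ := M.exists_rank_normal_form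
  rw [Matrix.isUnit_iff_isUnit_det] at hV hU
  filter_upwards [eventually_matrix_mem_regularAt V, eventually_matrix_mem_regularAt U,
    eventually_matrix_mem_regularAt M, eventually_matrix_mem_regularAt (V * M),
    eventually_ratEval_ne_zero hV.ne_zero, eventually_ratEval_ne_zero hU.ne_zero]
    with θ hVm hUm hMm hVMm hV0 hU0
  rw [map_det_of_mem (f := ratEval θ) (ratEvalHom θ) (fun _ => rfl) hVm] at hV0
  rw [map_det_of_mem (f := ratEval θ) (ratEvalHom θ) (fun _ => rfl) hUm] at hU0
  have h := congrArg (fun N => N.map (ratEval θ)) hE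
  simp only [map_mul_of_mem (f := ratEval θ) (ratEvalHom θ) (fun _ => rfl) hVMm hUm,
    map_mul_of_mem (f := ratEval θ) (ratEvalHom θ) (fun _ => rfl) hVm hMm, ← Matrix.submatrix_map,
    Matrix.fromBlocks_map, Matrix.map_one _ (ratEval_zero θ) (ratEval_one θ),
    Matrix.map_zero _ (ratEval_zero θ)] at h
  have h2 := congrArg Matrix.rank h
  rw [Matrix.rank_mul_eq_left_of_isUnit_det _ _ hU0.isUnit,
    Matrix.rank_mul_eq_right_of_isUnit_det _ _ hV0.isUnit] at h2
  rw [h2]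
  exact (rank_fromBlocks_one_zero e).trans (Fintype.card_fin _)

end Generic

/-! ### The model at generic parameter values -/

section Specialisation

variable {p s q K H : ℕ}

lemma genericCoeffs_mul_den {num den : Coeffs (MvPolynomial (Fin p) ℝ) s K H}
    (hden : ∀ k h a b, den k h a b ≠ 0) (k : Fin (K + 1)) (h : Fin (H + 1)) (a b : Fin s) :
    genericCoeffs num den k h a b * algebraMap _ (RatField p) (den k h a b) =
      algebraMap _ (RatField p) (num k h a b) := by
  rw [genericCoeffs, Matrix.of_apply]
  exact div_mul_cancel₀ _ ((map_ne_zero_iff _ (IsFractionRing.injective _ _)).2 (hden k h a b))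

/-- The coefficients `B` are the values at `θ` of the rational coefficients `A`, and no non-zero `A*_i`
vanishes at `θ`, so that `J₀` and `J₁` are preserved. -/
structure Specialises (A : Coeffs (RatField p) s K H) (B : Coeffs ℝ s K H) (θ : Fin p → ℝ) :
    Prop where
  mem : ∀ k h a b, A k h a b ∈ regularAt θ
  eq : ∀ k h a b, B k h a b = ratEval θ (A k h a b)
  Astar_ne : ∀ i, Astar A i ≠ 0 → (Astar A i).map (ratEval θ) ≠ 0

variable {A : Coeffs (RatField p) s K H} {B : Coeffs ℝ s K H} {θ : Fin p → ℝ}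

lemma Specialises.Astar_eq (h : Specialises A B θ) (i : ℤ) :
    Astar B i = (Astar A i).map (ratEval θ) := by
  ext a b
  have hm : ∀ (k : Fin (K + 1)) (l : Fin (H + 1)),
      (if ((l : ℕ) : ℤ) - ((k : ℕ) : ℤ) = i then A k l else 0) a b ∈ regularAt θ := by
    intro k l
    split_ifs
    exacts [h.mem k l a b, Subring.zero_mem _]
  rw [Matrix.map_apply, Astar, Astar]
  simp only [Matrix.sum_apply]
  rw [ratEval_sum fun k => Subring.sum_mem _ fun l _ => hm k l]
  refine Finset.sum_congr rfl fun k _ => ?_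
  rw [ratEval_sum (hm k)]
  refine Finset.sum_congr rfl fun l _ => ?_
  split_ifs
  exacts [h.eq k l a b, (ratEval_zero θ).symm]

lemma Specialises.setOf_Astar_ne_zero (h : Specialises A B θ) :
    {i : ℤ | Astar B i ≠ 0} = {i : ℤ | Astar A i ≠ 0} := by
  ext i
  rw [Set.mem_ofPred_eq, Set.mem_ofPred_eq, h.Astar_eq]
  refine ⟨fun h1 h2 => h1 ?_, h.Astar_ne i⟩
  rw [h2, Matrix.map_zero _ (ratEval_zero θ)]

lemma Specialises.J0_eq (h : Specialises A B θ) : J0 B = J0 A := by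
  rw [J0, J0, h.setOf_Astar_ne_zero]

lemma Specialises.J1_eq (h : Specialises A B θ) : J1 B = J1 A := by
  rw [J1, J1, h.setOf_Astar_ne_zero]

lemma Specialises.piPoly_eq (h : Specialises A B θ) :
    piPoly B = (piPoly A).map (polyAt θ) := by
  have hm : ∀ i a b, Astar A i a b ∈ regularAt θ := fun i a b => by
    rw [Astar, Matrix.sum_apply]
    refine Subring.sum_mem _ fun k _ => ?_
    rw [Matrix.sum_apply]
    refine Subring.sum_mem _ fun l _ => ?_
    split_ifs
    exacts [h.mem k l a b, Subring.zero_mem _]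
  ext a b n
  simp only [Matrix.map_apply, coeff_polyAt, piPoly, Matrix.sum_apply, finsetSum_coeff,
    coeff_monomial, h.J0_eq, h.J1_eq, h.Astar_eq]
  rw [ratEval_sum]
  · refine Finset.sum_congr rfl fun i _ => ?_
    split_ifs
    exacts [rfl, (ratEval_zero θ).symm]
  · intro i
    split_ifs
    exacts [hm i a b, Subring.zero_mem _]

lemma Specialises.zetaCoeff_mem (h : Specialises A B θ) (n : ℕ) (a : Fin s) (jb : Fin H × Fin s) :
    zetaCoeff A n a jb ∈ regularAt θ := by
  refine Subring.neg_mem _ (Subring.sum_mem _ fun k _ => Subring.sum_mem _ fun l _ => ?_)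
  split_ifs
  exacts [h.mem k l a jb.2, Subring.zero_mem _]

lemma Specialises.zetaCoeff_eq (h : Specialises A B θ) (n : ℕ) (a : Fin s) (jb : Fin H × Fin s) :
    zetaCoeff B n a jb = ratEval θ (zetaCoeff A n a jb) := by
  have hm : ∀ (k : Fin (K + 1)) (l : Fin (H + 1)),
      (if (l : ℕ) ≤ (jb.1 : ℕ) ∧ (k : ℕ) + (jb.1 : ℕ) = n + (l : ℕ) then
      A k l a jb.2 else 0) ∈ regularAt θ := by
    intro k l
    split_ifs
    exacts [h.mem k l a jb.2, Subring.zero_mem _]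
  simp only [zetaCoeff, Matrix.of_apply]
  rw [ratEval_neg (Subring.sum_mem _ fun k _ => Subring.sum_mem _ fun l _ => hm k l),
    ratEval_sum fun k => Subring.sum_mem _ fun l _ => hm k l]
  congr 1
  refine Finset.sum_congr rfl fun k _ => ?_
  rw [ratEval_sum (hm k)]
  refine Finset.sum_congr rfl fun l _ => ?_
  split_ifs
  exacts [h.eq k l a jb.2, (ratEval_zero θ).symm]

lemma Cmat_apply {F : Type*} [Field F] {A : Coeffs F s K H} (S : SmithForm (piPoly A))
    (ik jc : Fin H × Fin s) :
    Cmat S ik jc = ∑ n ∈ Finset.range (numLeads S), ∑ b,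
      (if 0 ≤ ((ik.1 : ℕ) : ℤ) + ((S.g ik.2 : ℕ) : ℤ) - J1 A - (n : ℤ) then
        (S.P⁻¹ ik.2 b).coeff (((ik.1 : ℕ) : ℤ) + ((S.g ik.2 : ℕ) : ℤ) - J1 A - (n : ℤ)).toNat
      else 0) * zetaCoeff A n b jc := by
  have h : Cmat S ik jc = ∑ nb : Fin (numLeads S) × Fin s,
      Dmat S ik nb * zetaCoeff A (nb.1 : ℕ) nb.2 jc := Matrix.mul_apply
  rw [h, Fintype.sum_prod_type, ← Fin.sum_univ_eq_sum_range (fun n => ∑ b,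
      (if 0 ≤ ((ik.1 : ℕ) : ℤ) + ((S.g ik.2 : ℕ) : ℤ) - J1 A - (n : ℤ) then
        (S.P⁻¹ ik.2 b).coeff (((ik.1 : ℕ) : ℤ) + ((S.g ik.2 : ℕ) : ℤ) - J1 A - (n : ℤ)).toNat
      else 0) * zetaCoeff A n b jc)]
  rfl

lemma Specialises.Cmat_eq (h : Specialises A B θ) {S : SmithForm (piPoly A)}
    {S' : SmithForm (piPoly B)} (hg : S'.g = S.g) (hP : S'.P⁻¹ = S.P⁻¹.map (polyAt θ))
    (hPm : ∀ i j, S.P⁻¹ i j ∈ polyRegularAt θ) : Cmat S' = (Cmat S).map (ratEval θ) := by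
  have hn : numLeads S' = numLeads S := by rw [numLeads, numLeads, h.J1_eq, hg]
  ext ik jc
  rw [Matrix.map_apply, Cmat_apply, Cmat_apply, hn, hg, hP, h.J1_eq]
  have hD : ∀ (n : ℕ) (b : Fin s),
      (if 0 ≤ ((ik.1 : ℕ) : ℤ) + ((S.g ik.2 : ℕ) : ℤ) - J1 A - (n : ℤ) then
        (S.P⁻¹ ik.2 b).coeff (((ik.1 : ℕ) : ℤ) + ((S.g ik.2 : ℕ) : ℤ) - J1 A - (n : ℤ)).toNat
      else 0) ∈ regularAt θ := by
    intro n b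
    split_ifs
    exacts [hPm _ _ _, Subring.zero_mem _]
  have hm := fun n b => Subring.mul_mem _ (hD n b) (h.zetaCoeff_mem n b jc)
  rw [ratEval_sum fun n => Subring.sum_mem _ fun b _ => hm n b]
  refine Finset.sum_congr rfl fun n _ => ?_
  rw [ratEval_sum (hm n)]
  refine Finset.sum_congr rfl fun b _ => ?_
  rw [ratEval_mul (hD n b) (h.zetaCoeff_mem n b jc), h.zetaCoeff_eq, Matrix.map_apply,
    coeff_polyAt]
  split_ifs
  exacts [rfl, by rw [ratEval_zero]]

lemma eventually_map_ratEval_ne_zero {M : Matrix (Fin s) (Fin s) (RatField p)} (hM : M ≠ 0) :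
    ∀ᶠ θ in generic p, M.map (ratEval θ) ≠ 0 := by
  obtain ⟨a, b, hab⟩ : ∃ a b, M a b ≠ 0 := by
    by_contra! h
    exact hM (Matrix.ext h)
  filter_upwards [eventually_ratEval_ne_zero hab] with θ h h0
  exact h (congrFun (congrFun h0 a) b)

lemma eventually_specialises {num den : Coeffs (MvPolynomial (Fin p) ℝ) s K H}
    (hden : ∀ k h a b, den k h a b ≠ 0) :
    ∀ᶠ θ in generic p, (∀ k h a b, MvPolynomial.eval θ (den k h a b) ≠ 0) ∧
      Specialises (genericCoeffs num den) (coeffsAt num den θ) θ := by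
  have h1 : ∀ᶠ θ in generic p, ∀ k h a b, MvPolynomial.eval θ (den k h a b) ≠ 0 := by
    simp only [Filter.eventually_all]
    exact fun k h a b => eventually_eval_ne_zero (hden k h a b)
  have h2 : ∀ᶠ θ in generic p, ∀ i ∈ Finset.Icc (-(K : ℤ)) H,
      Astar (genericCoeffs num den) i ≠ 0 →
        (Astar (genericCoeffs num den) i).map (ratEval θ) ≠ 0 := by
    refine (Filter.eventually_all_finset _).2 fun i _ => ?_
    by_cases hi : Astar (genericCoeffs num den) i = 0
    · exact Filter.Eventually.of_forall fun θ h => (h hi).elim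
    · filter_upwards [eventually_map_ratEval_ne_zero hi] with θ h _ using h
  filter_upwards [h1, h2] with θ hθ hA
  have hrep := fun k h a b => genericCoeffs_mul_den (num := num) hden k h a b
  refine ⟨hθ, fun k h a b => ⟨_, _, hθ k h a b, hrep k h a b⟩, fun k h a b => ?_, fun i hi => ?_⟩
  · exact (ratEval_eq_div (hθ k h a b) (hrep k h a b)).symm
  · exact hA i (Finset.mem_Icc.2 (Astar_ne_zero_bounds hi)) hi

/-- The regularity assumptions and the Smith form carry over to generic parameter values. -/
theorem eventually_smithForm {num den : Coeffs (MvPolynomial (Fin p) ℝ) s K H}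
    (hden : ∀ k h a b, den k h a b ≠ 0) (hreg : Regular (genericCoeffs num den))
    (S : SmithForm (piPoly (genericCoeffs num den))) :
    ∀ᶠ θ in generic p, (∀ k h a b, MvPolynomial.eval θ (den k h a b) ≠ 0) ∧
      Regular (coeffsAt num den θ) ∧ J1 (coeffsAt num den θ) = J1 (genericCoeffs num den) ∧
      ∃ S' : SmithForm (piPoly (coeffsAt num den θ)),
        S'.P = S.P.map (polyAt θ) ∧ S'.Q = S.Q.map (polyAt θ) ∧ S'.g = S.g ∧
        (∀ i, S'.φ i = polyAt θ (S.φ i)) ∧ (Cmat S').rank = (Cmat S).rank := by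
  obtain ⟨hrow, hrow0⟩ := hreg.last_row
  obtain ⟨hcol, hcol0⟩ := hreg.last_col
  have hdvd : ∀ᶠ θ in generic p, ∀ i j : Fin s, i ≤ j →
      polyAt θ (S.φ i) ∣ polyAt θ (S.φ j) := by
    simp only [Filter.eventually_all]
    exact fun i j hij => eventually_polyAt_dvd (S.φ_dvd i j hij)
  have hφ : ∀ᶠ θ in generic p, ∀ i, ratEval θ ((S.φ i).coeff 0) ≠ 0 :=
    Filter.eventually_all.2 fun i => eventually_ratEval_ne_zero (S.φ_zero i)
  let α : Matrix (Fin s) (Fin s) (RatField p)[X] := Matrix.diagonal fun i => X ^ S.g i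
  filter_upwards [eventually_specialises (num := num) hden, eventually_map_ratEval_ne_zero hrow0,
    eventually_map_ratEval_ne_zero hcol0, eventually_polyAt_ne_zero hreg.det_ne_zero,
    eventually_polyAt_det (piPoly (genericCoeffs num den)), hdvd, hφ,
    eventually_unimodular S.isUnit_det_P, eventually_unimodular S.isUnit_det_Q,
    eventually_map_polyAt_mul (S.P * α * Matrix.diagonal S.φ) S.Q,
    eventually_map_polyAt_mul (S.P * α) (Matrix.diagonal S.φ), eventually_map_polyAt_mul S.P α,
    eventually_matrix_mem_polyRegularAt S.P⁻¹, eventually_rank_map_ratEval (Cmat S)]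
    with θ ⟨hθ, hsp⟩ hr hc hdet hdet' hdvd hφ hP hQ hm1 hm2 hm3 hPm hrk
  have hmat : ∀ k h, coeffsAt num den θ k h = (genericCoeffs num den k h).map (ratEval θ) :=
    fun k h => Matrix.ext fun a b => hsp.eq k h a b
  refine ⟨hθ, ⟨⟨hrow, by rwa [hmat]⟩, ⟨hcol, by rwa [hmat]⟩, ?_⟩, hsp.J1_eq, ?_⟩
  · rwa [hsp.piPoly_eq, ← hdet']
  · refine ⟨⟨S.P.map (polyAt θ), S.Q.map (polyAt θ), S.g, fun i => polyAt θ (S.φ i), hP.1, hQ.1,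
      S.g_mono, hdvd, fun i => by rw [coeff_polyAt]; exact hφ i, ?_⟩, rfl, rfl, rfl,
      fun _ => rfl, ?_⟩
    · have h1 := congrArg (fun M => M.map (polyAt θ)) S.eq
      rw [hsp.piPoly_eq, h1, hm1, hm2, hm3]
      simp only [α, Matrix.diagonal_map (polyAt_zero θ), polyAt_X_pow]
    · rw [← hrk]
      congr 1
      exact hsp.Cmat_eq rfl hP.2 hPm

end Specialisation

end RE

theorem mainTheorem1 {p s q K H : ℕ}
    (num den : RE.Coeffs (MvPolynomial (Fin p) ℝ) s K H)
    (hden : ∀ k h a b, den k h a b ≠ 0)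
    (hreg : RE.Regular (RE.genericCoeffs num den))
    (S : RE.SmithForm (RE.piPoly (RE.genericCoeffs num den)))
    (w : ℕ) (hw : (RE.Cmat S).rank = w)
    (hbound : (w : ℤ) ≤ ((H : ℤ) - RE.J1 (RE.genericCoeffs num den)) * s
      + ∑ i, min ((S.g i : ℕ) : ℤ) (RE.J1 (RE.genericCoeffs num den))) :
    ∃ F : MvPolynomial (Fin p) ℝ, F ≠ 0 ∧
      ∀ θ : Fin p → ℝ, MvPolynomial.eval θ F ≠ 0 →
        -- the restrictions hold at `θ`, with the same `J₁`, partial multiplicities and rank `w`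
        (∀ k h a b, MvPolynomial.eval θ (den k h a b) ≠ 0) ∧
        RE.Regular (RE.coeffsAt num den θ) ∧
        RE.J1 (RE.coeffsAt num den θ) = RE.J1 (RE.genericCoeffs num den) ∧
        (∃ S' : RE.SmithForm (RE.piPoly (RE.coeffsAt num den θ)),
          S'.P = S.P.map (RE.polyAt θ) ∧ S'.Q = S.Q.map (RE.polyAt θ) ∧
          S'.g = S.g ∧ (∀ i, S'.φ i = RE.polyAt θ (S.φ i)) ∧ (RE.Cmat S').rank = w) ∧
        -- whichever Smith form is used at `θ` and whatever the exogenous process is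
        ∀ S' : RE.SmithForm (RE.piPoly (RE.coeffsAt num den θ)),
        ∀ w' : ℕ, (RE.Cmat S').rank = w' →
        ∀ (Ω : Type*) [MeasurableSpace Ω] (μ : Measure Ω) [IsProbabilityMeasure μ]
          (u : ℤ → Fin s → Lp ℝ 2 μ) (ε : ℤ → Fin q → Lp ℝ 2 μ)
          (W : ℕ → Matrix (Fin s) (Fin q) ℝ), RE.IsWold u ε W →
          -- the causal stationary solutions of the constrained SDE are those of the RE model
          (∀ y : ℤ → Fin s → Lp ℝ 2 μ, RE.IsCausalStationary ε y →
            (RE.IsRESolution (RE.coeffsAt num den θ) u y ↔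
              ∃ e : Fin H → ℤ → Fin s → Lp ℝ 2 μ, RE.IsMDS u e ∧ RE.Constraints S' u e ∧
                RE.IsSDESolution (RE.coeffsAt num den θ) u e y) ∧
            (RE.IsRESolution (RE.coeffsAt num den θ) u y ↔
              ∃ η ∈ RE.freeParams S' u ε,
                RE.IsSDESolution (RE.coeffsAt num den θ) u (RE.mds ε η) y)) ∧
          -- the parameters form an affine space of dimension `(Hs - w') q`
          ((RE.freeParams S' u ε).Nonempty →
            ∃ V : AffineSubspace ℝ (Matrix (Fin H × Fin s) (Fin q) ℝ),
              (V : Set (Matrix (Fin H × Fin s) (Fin q) ℝ)) = RE.freeParams S' u ε ∧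
              Module.finrank ℝ V.direction = (H * s - w') * q) ∧
          -- distinct parameters generate distinct causal stationary solutions
          (RE.NonzeroZerosOutside (RE.coeffsAt num den θ) →
            (∀ η ∈ RE.freeParams S' u ε, ∀ η' ∈ RE.freeParams S' u ε, η ≠ η' →
              ∀ y y' : ℤ → Fin s → Lp ℝ 2 μ,
                RE.IsCausalStationary ε y →
                RE.IsSDESolution (RE.coeffsAt num den θ) u (RE.mds ε η) y →
                RE.IsCausalStationary ε y' →
                RE.IsSDESolution (RE.coeffsAt num den θ) u (RE.mds ε η') y' → y ≠ y') ∧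
            (∀ η ∈ RE.freeParams S' u ε,
              ((∃! y : ℤ → Fin s → Lp ℝ 2 μ, RE.IsCausalStationary ε y ∧
                  RE.IsSDESolution (RE.coeffsAt num den θ) u (RE.mds ε η) y) ↔
                RE.CausalForcing S' u (RE.mds ε η)) ∧
              ((∀ k, ((S'.g k : ℕ) : ℤ) ≤ RE.J1 (RE.coeffsAt num den θ)) →
                RE.CausalForcing S' u (RE.mds ε η)))) := by
  subst hw
  obtain ⟨F, hF, h⟩ := RE.eventually_generic_iff.1 (RE.eventually_smithForm hden hreg S)
  refine ⟨F, hF, fun θ hθ => ?_⟩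
  obtain ⟨h1, h2, h3, h4⟩ := h θ hθ
  refine ⟨h1, h2, h3, h4, fun S' w' hw' Ω _ μ _ u ε W hW => ⟨fun y hy => ⟨?_, ?_⟩, ?_,
    fun hz => ⟨fun η hη η' hη' hne y y' hy hsde _ hsde' => ?_, fun η _ => ⟨?_, fun hg => ?_⟩⟩⟩⟩
  · exact RE.isRESolution_iff_exists_isMDS S' (hW.isCausalStationary_iff.1 hy).1
  · exact hW.isRESolution_iff_exists_freeParams S' hy
  · subst hw'
    exact hW.exists_affineSubspace_eq_freeParams S'
  · exact hW.ne_of_freeParams_ne S' hη hη' hne hy hsde hsde'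
  · exact hW.existsUnique_solution_iff S' hz η
  · exact RE.causalForcing_of_le S' (hW.isMDS η) hg
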